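/- Let $K$ be a field, $R$ a unital (not necessarily commutative) $K$-algebra, and $\mathrm{rk}$ a Sylvester matrix rank function for $R$, i.e. an $\mathbb{R}_{\ge 0}$-valued function on rectangular matrices over $R$ with $\mathrm{rk}(0)=0$, $\mathrm{rk}(1_R)=1$, $\mathrm{rk}(AB)\le\min(\mathrm{rk}A,\mathrm{rk}B)$, $\mathrm{rk}\begin{pmatrix}A&0\\0&B\end{pmatrix}=\mathrm{rk}A+\mathrm{rk}B$ and $\mathrm{rk}\begin{pmatrix}A&C\\0&B\end{pmatrix}\ge\mathrm{rk}A+\mathrm{rk}B$. Put $S=K(t)\otimes_K R$ with $t$ transcendental over $K$, regard $S$ as a left $R$-module via $1\otimes R$, and regard $R[t]\subseteq S$ by $rt^j\mapsto t^j\otimes r$. Let $\mathcal F$ be the collection of the left $R$-submodules $V\otimes_K R$ of $S$, with $V$ a finite-dimensional $K$-subspace of $K(t)$, let $\hat{\mathcal F}$ be the set of its nonzero members, and let $\dim(W)$ be the rank of the free $R$-module $W\in\mathcal F$. For finite $V\subseteq S$ and $\varepsilon>0$, call $W\in\hat{\mathcal F}$ $(V,\varepsilon)$-invariant if some $W'\in\mathcal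 F$ contains $W+WV$ and satisfies $\dim W'\le(1+\varepsilon)\dim W$. An ultrafilter $\omega$ on $\hat{\mathcal F}$ is called non-principal if, for all finite $V\subseteq S$ and all $\varepsilon>0$, it contains the set of all $(V,\varepsilon)$-invariant $W$. For $A\in M_{n,m}(S)$ and $W\in\hat{\mathcal F}$ choose $W'\in\hat{\mathcal F}$ with $WA_{ij}\subseteq W'$ for all $i,j$, and put $\mathrm{rk}_W(A)=\mathrm{rk}(B)$, where $B$ is the matrix over $R$ of the map $W^n\to W'^m$, $x\mapsto xA$, in $R$-bases of $W^n$ and $W'^m$ (the value does not depend on the choices). Put $\mathrm{rk}_{\mathcal F}(A)=\lim_{W\to\omega}\mathrm{rk}_W(A)/\dim(W)$. For a monic $f\in K[t]$ of degree $d\geq 1$, choose a basis of the free left $R$-module $R[t]/R[t]f$, let $\psi_f(a)\in M_d(R)$ be the matrix of right multiplication by $a\in R[t]$ on $R[t]/R[t]f$ in this basis, and put $\mathrm{rk}_f(A)=\frac1d\,\mathrm{rk}(\psi_f(A))$ for $A\in M_{n,m}(R[t])$ (the value does not depend on the basis). Then non-principal ultrafilters on $\hat{\mathcal F}$ exist,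 and for each of them, $\omega$, the limit $\mathrm{rk}_{\mathcal F}(A)$ exists for every matrix $A$ over $S$, and the following hold. 1. For every sequence $(f_i)_{i\in\mathbb N}$ of monic polynomials in $K[t]$ with $\deg f_i\to\infty$ and every $A\in M_{n,m}(R[t])$, $$\mathrm{rk}_{\mathcal F}(A)=\lim_{i\to\infty}\mathrm{rk}_{f_i}(A).$$ 2. Suppose that $\mathrm{rk}$ is regular, i.e. there are a unital ring homomorphism $\varphi:R\to R'$ to a von Neumann regular ring $R'$ and a Sylvester matrix rank function $\mathrm{rk}'$ for $R'$ with $\mathrm{rk}(A)=\mathrm{rk}'(\varphi(A))$ for all matrices $A$ over $R$. Then there is exactly one Sylvester matrix rank function $\mathrm{rk}_{K(t)\otimes_K R}$ for $S$ (Jaikin-Zapirain's extension of $\mathrm{rk}$) with $$\mathrm{rk}_{K(t)\otimes_K R}(A)=\lim_{i\to\infty}\mathrm{rk}_{t^i}(A)\quad\text{for all matrices } A \text{ over } R[t],$$ and $\mathrm{rk}_{K(t)\otimes_K R}(B)=\mathrm{rk}_{\mathcal F}(B)$ for every matrix $B$ over $S$. -/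

import Mathlib

open Filter Topology
open scoped TensorProduct Polynomial

universe u v w

noncomputable section

/-- A Sylvester matrix rank function for a unital ring `R`: a nonnegative real valued function on
all rectangular matrices over `R`. -/
structure SylvesterMatrixRank (R : Type v) [Ring R] where
  rk : ∀ {n m : ℕ}, Matrix (Fin n) (Fin m) R → ℝ
  nonneg : ∀ {n m : ℕ} (A : Matrix (Fin n) (Fin m) R), 0 ≤ rk A
  zero : ∀ n m : ℕ, rk (0 : Matrix (Fin n) (Fin m) R) = 0
  one : rk (1 : Matrix (Fin 1) (Fin 1) R) = 1
  mul_le_left : ∀ {n m l : ℕ} (A : Matrix (Fin n) (Fin m) R) (B : Matrix (Fin m) (Fin l) R),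
    rk (A * B) ≤ rk A
  mul_le_right : ∀ {n m l : ℕ} (A : Matrix (Fin n) (Fin m) R) (B : Matrix (Fin m) (Fin l) R),
    rk (A * B) ≤ rk B
  diag : ∀ {n m k l : ℕ} (A : Matrix (Fin n) (Fin m) R) (B : Matrix (Fin k) (Fin l) R),
    rk (Matrix.reindex finSumFinEquiv finSumFinEquiv (Matrix.fromBlocks A 0 0 B)) = rk A + rk B
  triangular : ∀ {n m k l : ℕ} (A : Matrix (Fin n) (Fin m) R) (C : Matrix (Fin n) (Fin l) R)
    (B : Matrix (Fin k) (Fin l) R),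
    rk A + rk B ≤
      rk (Matrix.reindex finSumFinEquiv finSumFinEquiv (Matrix.fromBlocks A C 0 B))

/-- `rk` is regular: it is induced by a unital ring homomorphism to a von Neumann regular ring
carrying a Sylvester matrix rank function. -/
def SylvesterMatrixRank.IsRegular {R : Type v} [Ring R] (rk : SylvesterMatrixRank R) : Prop :=
  ∃ (R' : Type w) (_ : Ring R') (φ : R →+* R') (rk' : SylvesterMatrixRank R'),
    (∀ a : R', ∃ b : R', a * b * a = a) ∧
      ∀ (n m : ℕ) (A : Matrix (Fin n) (Fin m) R), rk.rk A = rk'.rk (A.map φ)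

/-- The rank of a finitely generated free left module over a ring with invariant basis number
(for such a ring and module, the set below is a singleton). `Module.finrank` is not suitable
here: it has a junk value when `R` fails the strong rank condition. -/
def freeDim (R : Type v) [Ring R] (M : Type w) [AddCommGroup M] [Module R M] : ℕ :=
  sInf {d : ℕ | Nonempty (Module.Basis (Fin d) R M)}

section Approximation

variable {R : Type v} [Ring R] {S : Type w} [Ring S] [Module R S]

/-- The nonzero members of a collection `F` of left `R`-submodules of `S`. -/
abbrev NonzeroMem (F : Set (Submodule R S)) : Type w := {W : Submodule R S // W ∈ F ∧ W ≠ ⊥}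

/-- `W` is `(V, ε)`-invariant: `dim W' ≤ (1 + ε) dim W` for some `W'` in `F` that contains
`W + W V`. -/
def IsEpsInvariant (F : Set (Submodule R S)) (V : Finset S) (ε : ℝ) (W : Submodule R S) : Prop :=
  ∃ W' ∈ F, W ≤ W' ∧ (∀ x ∈ W, ∀ s ∈ V, x * s ∈ W') ∧
    (freeDim R W' : ℝ) ≤ (1 + ε) * (freeDim R W : ℝ)

/-- An ultrafilter on the nonzero members of `F` is non-principal if it contains, for every
finite `V ⊆ S` and every `ε > 0`, the set of all `(V, ε)`-invariant members. -/
def IsNonPrincipal (F : Set (Submodule R S)) (ω : Ultrafilter (NonzeroMem F)) : Prop :=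
  ∀ (V : Finset S) (ε : ℝ), 0 < ε → {W : NonzeroMem F | IsEpsInvariant F V ε W.1} ∈ ω

/-- `rk_W(A)` for a matrix `A` over `S`. Choose `W'` in `F` nonzero with `W A_{ij} ⊆ W'` for all
`i, j`, a basis `e` of `W ^ n` and a basis `e'` of `W' ^ m` over `R`. Then `rk_W(A) = rk B`,
where `B` is the matrix over `R` expressing the vectors `e_k A` in the basis `e'`. The set of all
values so obtained is a singleton for a finite approximation system `F`; `sInf` extracts its
element. -/
def rankAt (rk : SylvesterMatrixRank R) (F : Set (Submodule R S)) (W : Submodule R S) {n m : ℕ}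
    (A : Matrix (Fin n) (Fin m) S) : ℝ :=
  sInf {x : ℝ | ∃ (W' : NonzeroMem F) (l p : ℕ)
    (e : Module.Basis (Fin l) R (Fin n → W)) (e' : Module.Basis (Fin p) R (Fin m → W'.1))
    (B : Matrix (Fin l) (Fin p) R),
    (∀ i j, ∀ y ∈ W, y * A i j ∈ W'.1) ∧
    (∀ k, Matrix.vecMul (fun i => (e k i : S)) A = ∑ q, B k q • fun j => (e' q j : S)) ∧
    x = rk.rk B}

/-- `rk_W(A) / dim W`. -/
def normalizedRankAt (rk : SylvesterMatrixRank R) (F : Set (Submodule R S)) {n m : ℕ}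
    (A : Matrix (Fin n) (Fin m) S) (W : NonzeroMem F) : ℝ :=
  rankAt rk F W.1 A / (freeDim R W.1 : ℝ)

/-- `rk_F(A)`, the limit of `rk_W(A) / dim W` along the ultrafilter `ω`. -/
def rankF (rk : SylvesterMatrixRank R) (F : Set (Submodule R S)) (ω : Ultrafilter (NonzeroMem F))
    {n m : ℕ} (A : Matrix (Fin n) (Fin m) S) : ℝ :=
  limUnder (ω : Filter (NonzeroMem F)) (normalizedRankAt rk F A)

end Approximation

section FieldExtension

variable (K : Type u) [Field K] (E : Type w) [Field E] [Algebra K E] (R : Type v) [Ring R]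
  [Algebra K R]

/-- `E ⊗ R` as a left `R`-module, through left multiplication by the elements `1 ⊗ r`. -/
instance (priority := low) tensorLeftModule : Module R (E ⊗[K] R) :=
  Module.compHom (E ⊗[K] R)
    ((Algebra.TensorProduct.includeRight : R →ₐ[K] E ⊗[K] R) : R →+* E ⊗[K] R)

/-- The finite approximation system of `E ⊗ R`: all `V ⊗ R` with `V` a finite dimensional
`K`-subspace of `E`, where `V ⊗ R` is seen as the left `R`-submodule spanned by the `v ⊗ 1`. -/
def fieldSystem : Set (Submodule R (E ⊗[K] R)) :=
  {W | ∃ V : Submodule K E, FiniteDimensional K V ∧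
    W = Submodule.span R ((fun v : E => v ⊗ₜ[K] (1 : R)) '' (V : Set E))}

end FieldExtension

section Polynomials

variable {K : Type u} [Field K] (R : Type v) [Ring R] [Algebra K R]

/-- The left ideal `R[t] f` of `R[t]`, for `f` in `K[t]`. -/
def polyIdeal (f : K[X]) : Ideal R[X] := Ideal.span {f.map (algebraMap K R)}

theorem commute_polyMap (f : K[X]) (a : R[X]) : Commute (f.map (algebraMap K R)) a := by
  induction f using Polynomial.induction_on' with
  | add p q hp hq => rw [Polynomial.map_add]; exact hp.add_left hq
  | monomial n c =>
    rw [Polynomial.map_monomial, ← Polynomial.C_mul_X_pow_eq_monomial]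
    refine Commute.mul_left ?_ (Polynomial.commute_X_pow a n)
    ext i
    simp [Algebra.commutes]

instance polyIdeal_isTwoSided (f : K[X]) : (polyIdeal R f).IsTwoSided := by
  refine ⟨fun {a} b ha => ?_⟩
  rw [polyIdeal, Ideal.mem_span_singleton'] at ha ⊢
  obtain ⟨c, rfl⟩ := ha
  exact ⟨c * b, by rw [mul_assoc, mul_assoc, (commute_polyMap R f b).eq]⟩

/-- The quotient ring `R[t] / R[t] f`, which is also a left `R`-module. -/
abbrev PolyQuot (f : K[X]) : Type v := R[X] ⧸ polyIdeal R f

variable {R}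

/-- `ψ_{f,b}(a)`: the matrix over `R` of right multiplication by the class of `a` on
`R[t] / R[t] f`, in the basis `b`; that is, `b_k · [a] = ∑ l, ψ_{f,b}(a)_{k l} b_l`. -/
def psi {f : K[X]} {d : ℕ} (b : Module.Basis (Fin d) R (PolyQuot R f)) (a : R[X]) :
    Matrix (Fin d) (Fin d) R :=
  Matrix.of fun k l => b.repr (b k * Ideal.Quotient.mk (polyIdeal R f) a) l

/-- `ψ_{f,b}` applied to all entries of a matrix over `R[t]`, seen as an `nd × md` matrix. -/
def psiMatrix {f : K[X]} {d : ℕ} (b : Module.Basis (Fin d) R (PolyQuot R f)) {n m : ℕ}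
    (A : Matrix (Fin n) (Fin m) R[X]) : Matrix (Fin (n * d)) (Fin (m * d)) R :=
  Matrix.reindex finProdFinEquiv finProdFinEquiv
    (Matrix.of fun x y : _ × _ => psi b (A x.1 y.1) x.2 y.2)

/-- `rk_f(A) = rk(ψ_{f,b}(A)) / d` for `f` monic of degree `d` and any basis `b` of
`R[t] / R[t] f` over `R`; the value is the same for all `b`, so that `⨅` is that value. -/
def rankPoly (rk : SylvesterMatrixRank R) (f : K[X]) {n m : ℕ}
    (A : Matrix (Fin n) (Fin m) R[X]) : ℝ :=
  ⨅ b : Module.Basis (Fin f.natDegree) R (PolyQuot R f), rk.rk (psiMatrix b A) / f.natDegree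

variable (K R)

/-- The embedding of `R[t]` in `K(t) ⊗ R` with `r ↦ 1 ⊗ r` and `t ↦ t ⊗ 1`. -/
def polyToTensor : R[X] →+* RatFunc K ⊗[K] R :=
  Polynomial.eval₂RingHom'
    ((Algebra.TensorProduct.includeRight : R →ₐ[K] RatFunc K ⊗[K] R) : R →+* RatFunc K ⊗[K] R)
    (RatFunc.X ⊗ₜ[K] (1 : R)) (fun a => by simp [Commute, SemiconjBy])

variable {K R}

/-- `ρ` is Jaikin-Zapirain's extension of `rk` to `K(t) ⊗ R`: the Sylvester matrix rank function
whose value at a matrix over `R[t]` is the limit of `rk_{t^i}`. -/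
def IsJZExtension (rk : SylvesterMatrixRank R) (ρ : SylvesterMatrixRank (RatFunc K ⊗[K] R)) :
    Prop :=
  ∀ (n m : ℕ) (A : Matrix (Fin n) (Fin m) R[X]),
    Tendsto (fun i : ℕ => rankPoly rk ((Polynomial.X : K[X]) ^ i) A) atTop
      (𝓝 (ρ.rk (A.map (polyToTensor K R))))

end Polynomials

end

/-!
For a left `R`-module `M`, the rank `spanRank N` of a finitely generated submodule `N` is the
infimum of the ranks of matrices presenting generators of `N` in terms of vectors of `M`. It is
basis free, and it is the rank of the coordinate matrix of any generators of `N` with respect to a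
basis of a direct summand (`spanRank_span_eq`). Hence `rk_W(A)` is the rank of `W ^ n A`
(`rankAt_tens`), and `rk (ψ_f(A))` is the rank of the image of `A` on `(R[t] / R[t] f) ^ n`
(`rk_psiMatrix`); in particular both are independent of all choices. The block triangular axiom
makes `spanRank` submodular (`spanRank_sup_add_le`).

Fix `A` with `n` rows and let `φ V` be the rank of `(V ⊗ R) ^ n A` for finite dimensional
`V ⊆ K(t)`. This function is monotone, submodular, invariant under multiplication by nonzero
elements of `K(t)`, and it grows by at most `n` when a vector is added to `V`. Put
`h k = φ (K[t]_{≤ k}) - φ (K[t]_{< k})`. By submodularity and translation by `t`, `h` is decreasing,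
with limit `c`, say. For every `V ⊆ K[t]`, choose a basis of `V` with distinct degrees.

* A basis vector of degree `d` increases the rank at least as much over the span of the
  previous ones as over `K[t]_{< d}`, so `c * dim V ≤ φ V` (`mul_finrank_le`).
* If `V` is almost invariant under `t, …, t ^ k`, then for nearly all degrees the basis vector can
  be taken to be `t ^ k * u` with `u, t * u, …, t ^ (k - 1) * u` in `V`, and it then increases the
  rank by at most `h k` (`le_of_shifts`).

Clearing denominators carries this over to subspaces of `K(t)`, so that `φ V / dim V` tends to `c`
along every non-principal ultrafilter; it also tends to `c` for `V = K[t]_{< d}`, by Cesàro means.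
If `f` is monic of degree `d` and the entries of `A` have degree at most `k`, multiplication by `A`
modulo `f` agrees with multiplication by `A` on polynomials of degree less than `d - k`, so
`rk (ψ_f(A))` differs from `φ (K[t]_{< d})` by at most `n * k` (`abs_spanRank_sub_imageRank_le`).
This proves that `rk_F(A)` is the limit of the `rk_{f_i}(A)`.

Finally `rk_F` is a Sylvester matrix rank function (`sylvesterRankF`), whether or not `rk` is
regular: each `rk_W` has all the required properties except `rk (A B) ≤ rk B`, which holds up to an
error controlled by almost invariance. A Sylvester matrix rank function on `K(t) ⊗ R` is determined
by its values on matrices over `R[t]`, since denominators are central units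
(`rk_eq_of_isJZExtension`). So `rk_F` is the unique extension.
-/

noncomputable section

/-! ### Ranks of matrices and of finitely generated submodules -/

namespace SylvesterMatrixRank

section RankOfMatrices

variable {R : Type v} [Ring R] (rk : SylvesterMatrixRank R)

theorem rk_submatrix_le {n m n' m' : ℕ} (A : Matrix (Fin n) (Fin m) R) (e : Fin n' → Fin n)
    (f : Fin m' → Fin m) : rk.rk (A.submatrix e f) ≤ rk.rk A := by
  have h : A.submatrix e f =
      (1 : Matrix (Fin n) (Fin n) R).submatrix e (Equiv.refl _) * A *
        (1 : Matrix (Fin m) (Fin m) R).submatrix (Equiv.refl _) f := by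
    rw [Matrix.one_submatrix_mul, Matrix.mul_submatrix_one]
    ext i j
    simp
  rw [h]
  exact (rk.mul_le_left _ _).trans (rk.mul_le_right _ _)

/-- The rank of a matrix indexed by arbitrary finite types. -/
def rank {ι κ : Type*} [Fintype ι] [Fintype κ] (A : Matrix ι κ R) : ℝ :=
  rk.rk (A.submatrix (Fintype.equivFin ι).symm (Fintype.equivFin κ).symm)

variable {ι κ ι' κ' μ : Type*} [Fintype ι] [Fintype κ] [Fintype ι'] [Fintype κ'] [Fintype μ]

theorem rank_eq_rk {n m : ℕ} (A : Matrix ι κ R) (e : Fin n ≃ ι) (f : Fin m ≃ κ) :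
    rk.rank A = rk.rk (A.submatrix e f) := by
  apply le_antisymm
  · have := rk.rk_submatrix_le (A.submatrix e f) ((Fintype.equivFin ι).symm.trans e.symm)
      ((Fintype.equivFin κ).symm.trans f.symm)
    simpa [Matrix.submatrix_submatrix, Function.comp_def, rank] using this
  · have := rk.rk_submatrix_le (A.submatrix (Fintype.equivFin ι).symm (Fintype.equivFin κ).symm)
      (e.trans (Fintype.equivFin ι)) (f.trans (Fintype.equivFin κ))
    simpa [Matrix.submatrix_submatrix, Function.comp_def, rank] using this

theorem rank_fin {n m : ℕ} (A : Matrix (Fin n) (Fin m) R) : rk.rank A = rk.rk A := by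
  rw [rk.rank_eq_rk A (Equiv.refl _) (Equiv.refl _)]
  rfl

theorem rank_submatrix_equiv (A : Matrix ι κ R) (e : ι' ≃ ι) (f : κ' ≃ κ) :
    rk.rank (A.submatrix e f) = rk.rank A := by
  rw [rk.rank_eq_rk A ((Fintype.equivFin ι').symm.trans e) ((Fintype.equivFin κ').symm.trans f)]
  rfl

theorem rank_mul_le_left (A : Matrix ι κ R) (B : Matrix κ μ R) :
    rk.rank (A * B) ≤ rk.rank A := by
  have := rk.mul_le_left (A.submatrix (Fintype.equivFin ι).symm (Fintype.equivFin κ).symm)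
    (B.submatrix (Fintype.equivFin κ).symm (Fintype.equivFin μ).symm)
  rwa [Matrix.submatrix_mul_equiv] at this

theorem rank_mul_le_right (A : Matrix ι κ R) (B : Matrix κ μ R) :
    rk.rank (A * B) ≤ rk.rank B := by
  have := rk.mul_le_right (A.submatrix (Fintype.equivFin ι).symm (Fintype.equivFin κ).symm)
    (B.submatrix (Fintype.equivFin κ).symm (Fintype.equivFin μ).symm)
  rwa [Matrix.submatrix_mul_equiv] at this

theorem rank_fromBlocks_eq_rk (A : Matrix ι κ R) (B : Matrix ι κ' R) (C : Matrix ι' κ R)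
    (D : Matrix ι' κ' R) :
    rk.rank (Matrix.fromBlocks A B C D) =
      rk.rk (Matrix.reindex finSumFinEquiv finSumFinEquiv (Matrix.fromBlocks
        (A.submatrix (Fintype.equivFin ι).symm (Fintype.equivFin κ).symm)
        (B.submatrix (Fintype.equivFin ι).symm (Fintype.equivFin κ').symm)
        (C.submatrix (Fintype.equivFin ι').symm (Fintype.equivFin κ).symm)
        (D.submatrix (Fintype.equivFin ι').symm (Fintype.equivFin κ').symm))) := by
  rw [rk.rank_eq_rk _
    (finSumFinEquiv.symm.trans ((Fintype.equivFin ι).symm.sumCongr (Fintype.equivFin ι').symm))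
    (finSumFinEquiv.symm.trans ((Fintype.equivFin κ).symm.sumCongr (Fintype.equivFin κ').symm))]
  congr 1
  ext i j
  simp only [Matrix.reindex_apply, Matrix.submatrix_apply, Equiv.trans_apply]
  rcases finSumFinEquiv.symm i with i | i <;> rcases finSumFinEquiv.symm j with j | j <;> rfl

theorem rank_fromBlocks_diag (A : Matrix ι κ R) (B : Matrix ι' κ' R) :
    rk.rank (Matrix.fromBlocks A 0 0 B) = rk.rank A + rk.rank B := by
  rw [rank_fromBlocks_eq_rk]
  exact rk.diag _ _

theorem le_rank_fromBlocks (A : Matrix ι κ R) (C : Matrix ι κ' R) (B : Matrix ι' κ' R) :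
    rk.rank A + rk.rank B ≤ rk.rank (Matrix.fromBlocks A C 0 B) := by
  rw [rank_fromBlocks_eq_rk]
  exact rk.triangular _ _ _

theorem rk_one (n : ℕ) : rk.rk (1 : Matrix (Fin n) (Fin n) R) = n := by
  induction n with
  | zero =>
    rw [Subsingleton.elim (1 : Matrix (Fin 0) (Fin 0) R) 0, rk.zero]
    simp
  | succ n ih =>
    have := rk.diag (1 : Matrix (Fin n) (Fin n) R) (1 : Matrix (Fin 1) (Fin 1) R)
    rw [Matrix.fromBlocks_one, Matrix.reindex_apply, Matrix.submatrix_one_equiv, ih, rk.one] at this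
    rw [this]
    push_cast
    rfl

theorem rank_one [DecidableEq ι] : rk.rank (1 : Matrix ι ι R) = Fintype.card ι := by
  rw [rank, Matrix.submatrix_one_equiv, rk_one]

/-- The matrix form of submodularity: the rows of `C * X = D * Z` are common to the row spaces of
`X` and `Z`. -/
theorem rank_fromRows_add_le (X : Matrix ι κ R) (Z : Matrix ι' κ R) (C : Matrix μ ι R)
    (D : Matrix μ ι' R) (h : C * X = D * Z) :
    rk.rank (Matrix.fromRows X Z) + rk.rank (C * X) ≤ rk.rank X + rk.rank Z := by
  classical
  rw [← rk.rank_fromBlocks_diag X Z]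
  refine (rk.le_rank_fromBlocks (Matrix.fromRows X Z) (Matrix.fromRows X 0) (C * X)).trans ?_
  -- Row and column operations turn `diag(X, Z)` into this block triangular matrix.
  have key : Matrix.fromBlocks (Matrix.fromRows X Z) (Matrix.fromRows X 0) 0 (C * X) =
      Matrix.fromRows (1 : Matrix (ι ⊕ ι') (ι ⊕ ι') R) (Matrix.fromCols C (-D)) *
        Matrix.fromBlocks X 0 0 Z *
        (Matrix.fromBlocks 1 1 1 0 : Matrix (κ ⊕ κ) (κ ⊕ κ) R) := by
    rw [Matrix.fromRows_mul, Matrix.fromRows_mul, Matrix.one_mul, Matrix.fromCols_mul_fromBlocks,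
      Matrix.fromCols_mul_fromBlocks, Matrix.fromBlocks_multiply]
    ext i j
    rcases i with (i | i) | i <;> rcases j with j | j <;> simp [h]
  rw [key]
  exact (rk.rank_mul_le_left _ _).trans (rk.rank_mul_le_right _ _)

end RankOfMatrices

section SpanRank

variable {R : Type v} [Ring R] {M : Type*} [AddCommGroup M] [Module R M]
  {M' : Type*} [AddCommGroup M'] [Module R M']

/-- The linear map `p` takes the family `y` to the standard basis. For finite families, such a `p`
exists if and only if `y` is a basis of a direct summand. -/
def IsSplit {κ : Type*} [DecidableEq κ] (p : M →ₗ[R] κ → R) (y : κ → M) : Prop :=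
  ∀ j, p (y j) = Pi.single j 1

variable (R M) in
/-- Every finite subset lies in the span of a split finite family. -/
def LocallySplit : Prop :=
  ∀ s : Set M, s.Finite → ∃ (b : ℕ) (y : Fin b → M) (p : M →ₗ[R] Fin b → R),
    IsSplit p y ∧ s ⊆ Submodule.span R (Set.range y)

theorem IsSplit.apply_sum {κ : Type*} [Fintype κ] [DecidableEq κ] {p : M →ₗ[R] κ → R} {y : κ → M}
    (h : IsSplit p y) (c : κ → R) : p (∑ j, c j • y j) = c := by
  ext k
  simp [map_sum, h _, Pi.single_apply]

theorem IsSplit.sum_apply {κ : Type*} [Fintype κ] [DecidableEq κ] {p : M →ₗ[R] κ → R} {y : κ → M}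
    (h : IsSplit p y) {x : M} (hx : x ∈ Submodule.span R (Set.range y)) :
    ∑ j, p x j • y j = x := by
  obtain ⟨c, rfl⟩ := (Submodule.mem_span_range_iff_exists_fun R).1 hx
  rw [h.apply_sum]

theorem IsSplit.pi {κ : Type*} [DecidableEq κ] {p : M →ₗ[R] κ → R} {y : κ → M}
    (h : IsSplit p y) (m : ℕ) :
    IsSplit (R := R) (M := Fin m → M)
      (LinearMap.pi fun q : Fin m × κ => LinearMap.proj q.2 ∘ₗ p ∘ₗ LinearMap.proj q.1)
      (fun q : Fin m × κ => Pi.single q.1 (y q.2)) := by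
  rintro ⟨i, j⟩
  ext ⟨i', j'⟩
  by_cases hi : i' = i
  · subst hi
    simp [h j, Pi.single_apply]
  · simp [hi]

theorem isSplit_basis {κ : Type*} [Fintype κ] [DecidableEq κ] (b : Module.Basis κ R M) :
    IsSplit (b.equivFun : M →ₗ[R] κ → R) b := fun j => by
  ext i
  simp [Pi.single_apply, eq_comm]

theorem sum_smul_single {κ : Type*} [Fintype κ] {m : ℕ} (c : Fin m → κ → R) (y : κ → M) :
    ∑ q : Fin m × κ, c q.1 q.2 • Pi.single (M := fun _ => M) q.1 (y q.2) =
      fun s => ∑ j, c s j • y j := by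
  rw [Fintype.sum_prod_type]
  ext i
  simp [Finset.sum_apply, Pi.single_apply]

theorem mem_span_single {κ : Type*} [Fintype κ] (y : κ → M) {m : ℕ} {x : Fin m → M}
    (hx : ∀ i, x i ∈ Submodule.span R (Set.range y)) :
    x ∈ Submodule.span R
      (Set.range fun q : Fin m × κ => Pi.single (M := fun _ => M) q.1 (y q.2)) := by
  choose c hc using fun i => (Submodule.mem_span_range_iff_exists_fun R).1 (hx i)
  refine (Submodule.mem_span_range_iff_exists_fun R).2 ⟨fun q => c q.1 q.2, ?_⟩
  rw [sum_smul_single]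
  exact funext hc

theorem IsSplit.reindex {κ κ' : Type*} [DecidableEq κ] [DecidableEq κ'] {p : M →ₗ[R] κ → R}
    {y : κ → M} (h : IsSplit p y) (e : κ' ≃ κ) :
    IsSplit ((LinearMap.funLeft R R e) ∘ₗ p) (y ∘ e) := by
  intro j
  ext k
  simp [h _, LinearMap.funLeft_apply, Pi.single_apply]

theorem LocallySplit.pi (h : LocallySplit R M) (m : ℕ) : LocallySplit R (Fin m → M) := by
  intro s hs
  obtain ⟨b, y, p, hp, hy⟩ := h (⋃ i : Fin m, (fun x : Fin m → M => x i) '' s)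
    (Set.finite_iUnion fun i => hs.image _)
  refine ⟨m * b, _, _, (hp.pi m).reindex finProdFinEquiv.symm, fun x hx => ?_⟩
  rw [EquivLike.range_comp (fun q : Fin m × Fin b => Pi.single (M := fun _ => M) q.1 (y q.2))]
  exact mem_span_single y fun i => hy (Set.mem_iUnion.2 ⟨i, x, hx, rfl⟩)

variable (rk : SylvesterMatrixRank R)

/-- The rank of a finitely generated submodule `N` of a left module: the infimum of the ranks of the
matrices `B` such that `N` is contained in the span of the vectors `∑ j, B i j • y j` for some
family `y` in the module. (If `N` is not finitely generated, there may be no such `B`, and then the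
infimum has the junk value `0`.) -/
def spanRank (N : Submodule R M) : ℝ :=
  sInf {x : ℝ | ∃ (a b : ℕ) (B : Matrix (Fin a) (Fin b) R) (y : Fin b → M),
    N ≤ Submodule.span R (Set.range fun i => ∑ j, B i j • y j) ∧ x = rk.rk B}

theorem spanRank_le {ι κ : Type*} [Fintype ι] [Fintype κ] {N : Submodule R M} (B : Matrix ι κ R)
    (y : κ → M) (h : N ≤ Submodule.span R (Set.range fun i => ∑ j, B i j • y j)) :
    rk.spanRank N ≤ rk.rank B := by
  refine csInf_le ⟨0, ?_⟩ ⟨_, _, B.submatrix (Fintype.equivFin ι).symm (Fintype.equivFin κ).symm,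
    y ∘ (Fintype.equivFin κ).symm, ?_, rfl⟩
  · rintro _ ⟨a, b, B, y, -, rfl⟩
    exact rk.nonneg B
  · have : (fun i => ∑ j, B.submatrix (Fintype.equivFin ι).symm (Fintype.equivFin κ).symm i j •
        (y ∘ (Fintype.equivFin κ).symm) j) =
        (fun i => ∑ j, B i j • y j) ∘ (Fintype.equivFin ι).symm := by
      ext i
      exact Equiv.sum_comp (Fintype.equivFin κ).symm
        (fun j => B ((Fintype.equivFin ι).symm i) j • y j)
    rwa [this, EquivLike.range_comp]

theorem exists_presentation {N : Submodule R M} (hN : N.FG) :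
    ∃ (a b : ℕ) (B : Matrix (Fin a) (Fin b) R) (y : Fin b → M),
      N ≤ Submodule.span R (Set.range fun i => ∑ j, B i j • y j) := by
  obtain ⟨n, s, rfl⟩ := Submodule.fg_iff_exists_fin_generating_family.1 hN
  refine ⟨n, n, 1, s, ?_⟩
  simp [Matrix.one_apply]

theorem le_spanRank {N : Submodule R M} (hN : N.FG) {c : ℝ}
    (h : ∀ (a b : ℕ) (B : Matrix (Fin a) (Fin b) R) (y : Fin b → M),
      N ≤ Submodule.span R (Set.range fun i => ∑ j, B i j • y j) → c ≤ rk.rk B) :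
    c ≤ rk.spanRank N := by
  obtain ⟨a, b, B, y, hy⟩ := exists_presentation hN
  refine le_csInf ⟨_, a, b, B, y, hy, rfl⟩ ?_
  rintro _ ⟨a, b, B, y, hy, rfl⟩
  exact h a b B y hy

theorem spanRank_nonneg (N : Submodule R M) : 0 ≤ rk.spanRank N := by
  apply Real.sInf_nonneg
  rintro _ ⟨a, b, B, y, hy, rfl⟩
  exact rk.nonneg B

theorem spanRank_mono {N N' : Submodule R M} (hN : N'.FG) (h : N ≤ N') :
    rk.spanRank N ≤ rk.spanRank N' :=
  rk.le_spanRank hN fun a b B y hy => by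
    rw [← rank_fin]
    exact rk.spanRank_le B y (h.trans hy)

theorem spanRank_map_le {N : Submodule R M} (hN : N.FG) (f : M →ₗ[R] M') :
    rk.spanRank (N.map f) ≤ rk.spanRank N :=
  rk.le_spanRank hN fun a b B y hy => by
    rw [← rank_fin]
    refine rk.spanRank_le B (f ∘ y) ((Submodule.map_mono hy).trans ?_)
    rw [Submodule.map_span, ← Set.range_comp]
    simp [Function.comp_def, map_sum]

theorem spanRank_span_le {ι : Type*} [Fintype ι] (x : ι → M) :
    rk.spanRank (Submodule.span R (Set.range x)) ≤ Fintype.card ι := by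
  classical
  rw [← rk.rank_one]
  refine rk.spanRank_le 1 x ?_
  simp [Matrix.one_apply]

/-- A split family computes the rank: by definition for `≤`; for `≥`, coordinates of a
presentation of the given vectors write `B` as a product with the presenting matrix as a factor. -/
theorem spanRank_span_eq {ι κ : Type*} [Fintype ι] [Fintype κ] [DecidableEq κ]
    {p : M →ₗ[R] κ → R} {y : κ → M} (h : IsSplit p y) (B : Matrix ι κ R) :
    rk.spanRank (Submodule.span R (Set.range fun i => ∑ j, B i j • y j)) = rk.rank B := by
  refine le_antisymm (rk.spanRank_le B y le_rfl) (rk.le_spanRank ?_ ?_)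
  · exact Submodule.fg_span (Set.finite_range _)
  · intro a b C z hz
    have hx (i : ι) : ∑ j, B i j • y j ∈
        Submodule.span R (Set.range fun i => ∑ j, C i j • z j) :=
      hz (Submodule.subset_span ⟨i, rfl⟩)
    choose D hD using fun i => (Submodule.mem_span_range_iff_exists_fun R).1 (hx i)
    have hB : B = (Matrix.of D : Matrix ι (Fin a) R) * C * (Matrix.of fun j => p (z j)) := by
      ext i k
      have := congrFun (congrArg p (hD i)) k
      rw [h.apply_sum] at this
      rw [← this, Matrix.mul_assoc, Matrix.mul_apply]
      simp [map_sum, Finset.sum_apply, Matrix.mul_apply]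
    rw [hB, ← rank_fin]
    exact (rk.rank_mul_le_left _ _).trans (rk.rank_mul_le_right _ _)

theorem spanRank_span_eq_coord {ι κ : Type*} [Fintype ι] [Fintype κ] [DecidableEq κ]
    {p : M →ₗ[R] κ → R} {y : κ → M} (h : IsSplit p y) (x : ι → M)
    (hx : ∀ i, x i ∈ Submodule.span R (Set.range y)) :
    rk.spanRank (Submodule.span R (Set.range x)) = rk.rank (Matrix.of fun i j => p (x i) j) := by
  rw [← rk.spanRank_span_eq h]
  congr 3
  ext i
  exact (h.sum_apply (hx i)).symm

theorem IsSplit.spanRank_span_range {κ : Type*} [Fintype κ] [DecidableEq κ] {p : M →ₗ[R] κ → R}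
    {y : κ → M} (h : IsSplit p y) :
    rk.spanRank (Submodule.span R (Set.range y)) = Fintype.card κ := by
  rw [← rk.rank_one, ← rk.spanRank_span_eq h]
  simp [Matrix.one_apply]

theorem spanRank_bot : rk.spanRank (⊥ : Submodule R M) = 0 := by
  apply le_antisymm _ (rk.spanRank_nonneg _)
  have := rk.spanRank_span_le (fun i : Fin 0 => (0 : M))
  simpa using this

/-- Submodularity of `spanRank`, by taking coordinates in one split family. The intersection of `N₁`
and `N₂` need not be finitely generated, whence the auxiliary `N`. -/
theorem spanRank_sup_add_le (hM : LocallySplit R M) {N₁ N₂ N : Submodule R M} (h₁ : N₁.FG)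
    (h₂ : N₂.FG) (h : N.FG) (hN₁ : N ≤ N₁) (hN₂ : N ≤ N₂) :
    rk.spanRank (N₁ ⊔ N₂) + rk.spanRank N ≤ rk.spanRank N₁ + rk.spanRank N₂ := by
  obtain ⟨a, x, rfl⟩ := Submodule.fg_iff_exists_fin_generating_family.1 h₁
  obtain ⟨b, z, rfl⟩ := Submodule.fg_iff_exists_fin_generating_family.1 h₂
  obtain ⟨c, y, rfl⟩ := Submodule.fg_iff_exists_fin_generating_family.1 h
  obtain ⟨d, t, p, hp, ht⟩ := hM (Set.range x ∪ Set.range z)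
    ((Set.finite_range _).union (Set.finite_range _))
  have hx : ∀ i, x i ∈ Submodule.span R (Set.range t) := fun i => ht (Or.inl ⟨i, rfl⟩)
  have hz : ∀ i, z i ∈ Submodule.span R (Set.range t) := fun i => ht (Or.inr ⟨i, rfl⟩)
  have hyx (i) : y i ∈ Submodule.span R (Set.range x) := hN₁ (Submodule.subset_span ⟨i, rfl⟩)
  have hyz (i) : y i ∈ Submodule.span R (Set.range z) := hN₂ (Submodule.subset_span ⟨i, rfl⟩)
  have hy : ∀ i, y i ∈ Submodule.span R (Set.range t) := fun i =>
    Submodule.span_le.2 (by rintro _ ⟨j, rfl⟩; exact hx j) (hyx i)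
  choose C hC using fun i => (Submodule.mem_span_range_iff_exists_fun R).1 (hyx i)
  choose D hD using fun i => (Submodule.mem_span_range_iff_exists_fun R).1 (hyz i)
  rw [← Submodule.span_union, ← Set.Sum.elim_range,
    rk.spanRank_span_eq_coord hp x hx, rk.spanRank_span_eq_coord hp z hz,
    rk.spanRank_span_eq_coord hp y hy,
    rk.spanRank_span_eq_coord hp (Sum.elim x z) (by rintro (i | i) <;> simp [hx, hz])]
  have e₁ : (Matrix.of fun i j => p (y i) j) =
      (Matrix.of C : Matrix (Fin c) (Fin a) R) * (Matrix.of fun i j => p (x i) j) := by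
    ext i j
    simp [← hC, Matrix.mul_apply]
  have e₂ : (Matrix.of fun i j => p (y i) j) =
      (Matrix.of D : Matrix (Fin c) (Fin b) R) * (Matrix.of fun i j => p (z i) j) := by
    ext i j
    simp [← hD, Matrix.mul_apply]
  have e₃ : (Matrix.of fun i j => p (Sum.elim x z i) j) =
      Matrix.fromRows (Matrix.of fun i j => p (x i) j) (Matrix.of fun i j => p (z i) j) := by
    ext (i | i) j <;> rfl
  have := rk.rank_fromRows_add_le _ _ _ _ (e₁.symm.trans e₂)
  rwa [← e₁, ← e₃] at this

theorem spanRank_sup_le (hM : LocallySplit R M) {N₁ N₂ : Submodule R M} (h₁ : N₁.FG)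
    (h₂ : N₂.FG) : rk.spanRank (N₁ ⊔ N₂) ≤ rk.spanRank N₁ + rk.spanRank N₂ := by
  have := rk.spanRank_sup_add_le hM h₁ h₂ Submodule.fg_bot bot_le bot_le
  rwa [spanRank_bot, add_zero] at this

end SpanRank

end SylvesterMatrixRank

/-! ### The submodules `V ⊗ R` of `E ⊗ R` and their images under matrices -/

theorem SylvesterMatrixRank.nontrivial {R : Type v} [Ring R] (rk : SylvesterMatrixRank R) :
    Nontrivial R := by
  by_contra h
  rw [not_nontrivial_iff_subsingleton] at h
  have := rk.one
  rw [Subsingleton.elim (1 : Matrix (Fin 1) (Fin 1) R) 0, rk.zero] at this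
  exact zero_ne_one this

namespace FieldTensor

variable {K : Type u} [Field K] {E : Type w} [Field E] [Algebra K E] {R : Type v} [Ring R]
  [Algebra K R]

theorem smul_def (r : R) (x : E ⊗[K] R) : r • x = ((1 : E) ⊗ₜ[K] r) * x := rfl

theorem smul_tmul_right (r s : R) (e : E) : r • (e ⊗ₜ[K] s) = e ⊗ₜ[K] (r * s) := by
  rw [smul_def, Algebra.TensorProduct.tmul_mul_tmul, one_mul]

instance : IsScalarTower R (E ⊗[K] R) (E ⊗[K] R) :=
  ⟨fun r x y => by rw [smul_eq_mul, smul_eq_mul, smul_def, smul_def, mul_assoc]⟩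

theorem commute_tmul_one (e : E) (x : E ⊗[K] R) : Commute (e ⊗ₜ[K] (1 : R)) x := by
  induction x using TensorProduct.induction_on with
  | zero => exact Commute.zero_right _
  | tmul f r => simp [Commute, SemiconjBy, mul_comm]
  | add x y hx hy => exact hx.add_right hy

/-- The left `R`-submodule `V ⊗ R` of `E ⊗ R`. -/
def tens (R : Type v) [Ring R] [Algebra K R] (V : Submodule K E) : Submodule R (E ⊗[K] R) :=
  Submodule.span R ((fun v : E => v ⊗ₜ[K] (1 : R)) '' (V : Set E))

theorem tmul_mem_tens {V : Submodule K E} {e : E} (he : e ∈ V) (r : R) :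
    e ⊗ₜ[K] r ∈ tens R V := by
  have := (tens R V).smul_mem r (Submodule.subset_span ⟨e, he, rfl⟩)
  simpa only [smul_tmul_right, mul_one] using this

theorem tens_mono {V V' : Submodule K E} (h : V ≤ V') : tens R V ≤ tens R V' :=
  Submodule.span_mono (Set.image_mono h)

theorem tens_span (s : Set E) :
    tens R (Submodule.span K s) = Submodule.span R ((fun v : E => v ⊗ₜ[K] (1 : R)) '' s) := by
  apply le_antisymm
  · refine Submodule.span_le.2 ?_
    rintro _ ⟨v, hv, rfl⟩
    induction hv using Submodule.span_induction with
    | mem x hx => exact Submodule.subset_span ⟨x, hx, rfl⟩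
    | zero => simp
    | add x y _ _ hx hy => simpa [TensorProduct.add_tmul] using add_mem hx hy
    | smul a x _ hx =>
      have := Submodule.smul_mem _ (algebraMap K R a) hx
      simpa [smul_tmul_right, TensorProduct.smul_tmul, Algebra.algebraMap_eq_smul_one] using this
  · exact Submodule.span_mono (Set.image_mono Submodule.subset_span)

theorem tens_sup (V V' : Submodule K E) : tens R (V ⊔ V') = tens R V ⊔ tens R V' := by
  conv_lhs => rw [← Submodule.span_eq V, ← Submodule.span_eq V', ← Submodule.span_union, tens_span,
    Set.image_union, Submodule.span_union]
  rfl

theorem tens_bot : tens R (⊥ : Submodule K E) = ⊥ := by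
  simp [tens]

theorem tens_eq_span_basis {κ : Type*} {V : Submodule K E} (b : Module.Basis κ K V) :
    tens R V = Submodule.span R (Set.range fun j => (b j : E) ⊗ₜ[K] (1 : R)) := by
  have : V = Submodule.span K (Set.range fun j => (b j : E)) := by
    have h := congrArg (Submodule.map V.subtype) b.span_eq
    rw [Submodule.map_span, ← Set.range_comp, Submodule.map_top, Submodule.range_subtype] at h
    exact h.symm
  conv_lhs => rw [this, tens_span, ← Set.range_comp]
  rfl

theorem tens_fg (V : Submodule K E) [FiniteDimensional K V] : (tens R V).FG := by
  rw [tens_eq_span_basis (Module.finBasis K V)]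
  exact Submodule.fg_span (Set.finite_range _)

theorem mul_mem_tens {V L V' : Submodule K E} (h : V * L ≤ V') {x y : E ⊗[K] R}
    (hx : x ∈ tens R V) (hy : y ∈ tens R L) : x * y ∈ tens R V' := by
  induction hx using Submodule.span_induction with
  | zero => simp
  | add a b _ _ ha hb => rw [add_mul]; exact add_mem ha hb
  | smul r a _ ha => rw [smul_mul_assoc]; exact Submodule.smul_mem _ r ha
  | mem a ha =>
    obtain ⟨v, hv, rfl⟩ := ha
    induction hy using Submodule.span_induction with
    | zero => simp
    | add a b _ _ ha hb => rw [mul_add]; exact add_mem ha hb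
    | smul r a _ ha =>
      dsimp only
      rw [(commute_tmul_one v (r • a)).eq, smul_mul_assoc, ← (commute_tmul_one v a).eq]
      exact Submodule.smul_mem _ r ha
    | mem a ha =>
      obtain ⟨l, hl, rfl⟩ := ha
      simpa using tmul_mem_tens (R := R) (h (Submodule.mul_mem_mul hv hl)) 1

variable (R) in
/-- The extension of a `K`-linear functional on `E` to an `R`-linear functional on `E ⊗ R`. -/
def extendFunctional (l : E →ₗ[K] K) : E ⊗[K] R →ₗ[R] R where
  toFun := TensorProduct.lid K R ∘ₗ l.rTensor R
  map_add' := map_add _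
  map_smul' r x := by
    induction x using TensorProduct.induction_on with
    | zero => simp
    | tmul e s => simp [smul_tmul_right]
    | add x y hx hy => rw [smul_add, map_add, map_add, hx, hy, smul_add]

@[simp]
theorem extendFunctional_tmul (l : E →ₗ[K] K) (e : E) (r : R) :
    extendFunctional R l (e ⊗ₜ[K] r) = l e • r := by
  simp [extendFunctional]

open SylvesterMatrixRank

theorem exists_isSplit {κ : Type*} [Fintype κ] [DecidableEq κ] {V : Submodule K E}
    (b : Module.Basis κ K V) :
    ∃ p : E ⊗[K] R →ₗ[R] κ → R, IsSplit p fun j => (b j : E) ⊗ₜ[K] (1 : R) := by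
  obtain ⟨g, hg⟩ := LinearMap.exists_extend (b.equivFun : V →ₗ[K] κ → K)
  refine ⟨LinearMap.pi fun i => extendFunctional R (LinearMap.proj i ∘ₗ g), fun j => ?_⟩
  ext i
  have : g (b j : E) = Pi.single j 1 := by
    have := LinearMap.congr_fun hg (b j)
    ext k
    simpa [Finsupp.single_apply, Pi.single_apply, eq_comm] using congrFun this k
  simp only [LinearMap.pi_apply, extendFunctional_tmul, LinearMap.comp_apply, LinearMap.proj_apply,
    this]
  by_cases h : i = j <;> simp [h]

theorem tmul_one_mem_tens_iff [Nontrivial R] {V : Submodule K E} {e : E} :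
    e ⊗ₜ[K] (1 : R) ∈ tens R V ↔ e ∈ V := by
  refine ⟨fun h => ?_, fun h => tmul_mem_tens h 1⟩
  by_contra he
  obtain ⟨l, hl, hV⟩ := Submodule.exists_le_ker_of_notMem he
  have h0 : ∀ x ∈ tens R V, extendFunctional R l x = 0 := by
    intro x hx
    induction hx using Submodule.span_induction with
    | zero => simp
    | add a b _ _ ha hb => rw [map_add, ha, hb, add_zero]
    | smul r a _ ha => rw [map_smul, ha, smul_zero]
    | mem a ha =>
      obtain ⟨_, hv, rfl⟩ := ha
      have : l _ = 0 := hV hv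
      simp [this]
  have := h0 _ h
  rw [extendFunctional_tmul] at this
  rcases smul_eq_zero.1 this with h | h
  · exact hl h
  · exact one_ne_zero h

theorem tens_le_tens_iff [Nontrivial R] {V V' : Submodule K E} :
    tens R V ≤ tens R V' ↔ V ≤ V' :=
  ⟨fun h _ hv => tmul_one_mem_tens_iff.1 (h (tmul_mem_tens hv (1 : R))), tens_mono⟩

theorem exists_mem_tens (x : E ⊗[K] R) :
    ∃ L : Submodule K E, FiniteDimensional K L ∧ x ∈ tens R L := by
  induction x using TensorProduct.induction_on with
  | zero => exact ⟨⊥, inferInstance, by simp⟩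
  | tmul e r =>
    exact ⟨K ∙ e, inferInstance, tmul_mem_tens (Submodule.mem_span_singleton_self e) r⟩
  | add x y hx hy =>
    obtain ⟨L₁, _, h₁⟩ := hx
    obtain ⟨L₂, _, h₂⟩ := hy
    exact ⟨L₁ ⊔ L₂, inferInstance,
      add_mem (tens_mono le_sup_left h₁) (tens_mono le_sup_right h₂)⟩

theorem exists_subset_tens (s : Set (E ⊗[K] R)) (hs : s.Finite) :
    ∃ L : Submodule K E, FiniteDimensional K L ∧ s ⊆ tens R L := by
  induction s, hs using Set.Finite.induction_on with
  | empty => exact ⟨⊥, inferInstance, by simp⟩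
  | @insert x s _ _ ih =>
    obtain ⟨L, hL, h⟩ := ih
    obtain ⟨L', hL', h'⟩ := exists_mem_tens x
    refine ⟨L' ⊔ L, inferInstance, Set.insert_subset (tens_mono le_sup_left h') ?_⟩
    exact h.trans (tens_mono le_sup_right)

variable (K E R) in
theorem locallySplit : LocallySplit R (E ⊗[K] R) := by
  intro s hs
  obtain ⟨L, hL, h⟩ := exists_subset_tens s hs
  obtain ⟨p, hp⟩ := exists_isSplit (R := R) (Module.finBasis K L)
  exact ⟨_, _, p, hp, by rwa [tens_eq_span_basis (Module.finBasis K L)] at h⟩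

/-- `V ⊗ R` is a direct summand of `E ⊗ R`. -/
theorem exists_retraction (V : Submodule K E) [FiniteDimensional K V] :
    ∃ r : E ⊗[K] R →ₗ[R] tens R V, ∀ x : tens R V, r x = x := by
  obtain ⟨p, hp⟩ := exists_isSplit (R := R) (Module.finBasis K V)
  have hmem (j) : ((Module.finBasis K V j : E) ⊗ₜ[K] (1 : R)) ∈ tens R V :=
    tmul_mem_tens (Subtype.coe_prop _) 1
  refine ⟨(Fintype.linearCombination R fun j =>
    (⟨(Module.finBasis K V j : E) ⊗ₜ[K] (1 : R), hmem j⟩ : tens R V)) ∘ₗ p, fun x => ?_⟩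
  ext
  have hx := (tens_eq_span_basis (R := R) (Module.finBasis K V)).le x.2
  simpa [Fintype.linearCombination_apply] using hp.sum_apply hx

theorem exists_isSplit_of_basis {κ : Type*} [Fintype κ] [DecidableEq κ] {V : Submodule K E}
    [FiniteDimensional K V] {m : ℕ} (e : Module.Basis κ R (Fin m → tens R V)) :
    ∃ p : (Fin m → E ⊗[K] R) →ₗ[R] κ → R, IsSplit p fun q j => (e q j : E ⊗[K] R) := by
  obtain ⟨r, hr⟩ := exists_retraction (R := R) V
  refine ⟨e.equivFun ∘ₗ LinearMap.pi fun j => r ∘ₗ LinearMap.proj j, fun q => ?_⟩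
  have : (LinearMap.pi fun j => r ∘ₗ LinearMap.proj j) (fun j => (e q j : E ⊗[K] R)) = e q := by
    ext j
    simp [hr]
  rw [LinearMap.comp_apply, this]
  exact isSplit_basis e q

theorem nonempty_basis_tens (V : Submodule K E) [FiniteDimensional K V] :
    Nonempty (Module.Basis (Fin (Module.finrank K V)) R (tens R V)) := by
  obtain ⟨p, hp⟩ := exists_isSplit (R := R) (Module.finBasis K V)
  rw [tens_eq_span_basis (Module.finBasis K V)]
  refine ⟨Module.Basis.span (Fintype.linearIndependent_iff.2 fun c hc => ?_)⟩
  have := hp.apply_sum c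
  rw [hc, map_zero] at this
  exact congrFun this.symm

/-- Free modules over a ring with a Sylvester rank function have a well defined rank. -/
theorem card_eq_of_basis (rk : SylvesterMatrixRank R) {M : Type*} [AddCommGroup M]
    [Module R M] {d d' : ℕ} (b : Module.Basis (Fin d) R M) (b' : Module.Basis (Fin d') R M) : d = d' := by
  have key {d : ℕ} (b : Module.Basis (Fin d) R M) : rk.spanRank (⊤ : Submodule R M) = d := by
    rw [← b.span_eq, (isSplit_basis b).spanRank_span_range, Fintype.card_fin]
  have := (key b).symm.trans (key b')
  exact_mod_cast this

theorem freeDim_tens (rk : SylvesterMatrixRank R) (V : Submodule K E) [FiniteDimensional K V] :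
    freeDim R (tens R V) = Module.finrank K V := by
  obtain ⟨b⟩ := nonempty_basis_tens (R := R) V
  have : {d : ℕ | Nonempty (Module.Basis (Fin d) R (tens R V))} = {Module.finrank K V} := by
    ext d
    exact ⟨fun ⟨b'⟩ => card_eq_of_basis rk b' b, fun h => by rw [Set.mem_singleton_iff.1 h]; exact ⟨b⟩⟩
  rw [freeDim, this, csInf_singleton]

variable (rk : SylvesterMatrixRank R)

/-- The left `R`-linear map `s ↦ s a` to `(E ⊗ R) ^ m`, for a row vector `a`. -/
def rowMul {m : ℕ} (a : Fin m → E ⊗[K] R) : E ⊗[K] R →ₗ[R] Fin m → E ⊗[K] R where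
  toFun s := fun j => s * a j
  map_add' x y := by ext j; simp [add_mul]
  map_smul' r x := by ext j; simp [smul_mul_assoc]

theorem rowMul_apply {m : ℕ} (a : Fin m → E ⊗[K] R) (s : E ⊗[K] R) (j : Fin m) :
    rowMul a s j = s * a j := rfl

/-- The image `W ^ n A` of `W ^ n` under right multiplication by the matrix `A`. -/
def rowSpan {n m : ℕ} (A : Matrix (Fin n) (Fin m) (E ⊗[K] R)) (W : Submodule R (E ⊗[K] R)) :
    Submodule R (Fin m → E ⊗[K] R) :=
  ⨆ i, W.map (rowMul (A i))

variable {n m : ℕ} (A : Matrix (Fin n) (Fin m) (E ⊗[K] R))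

theorem rowSpan_mono {W W' : Submodule R (E ⊗[K] R)} (h : W ≤ W') : rowSpan A W ≤ rowSpan A W' :=
  iSup_mono fun _ => Submodule.map_mono h

theorem rowSpan_sup (W W' : Submodule R (E ⊗[K] R)) :
    rowSpan A (W ⊔ W') = rowSpan A W ⊔ rowSpan A W' := by
  simp only [rowSpan, Submodule.map_sup, iSup_sup_eq]

theorem rowSpan_bot : rowSpan A ⊥ = ⊥ := by
  simp [rowSpan]

theorem rowSpan_fg {W : Submodule R (E ⊗[K] R)} (hW : W.FG) : (rowSpan A W).FG :=
  Submodule.fg_iSup _ fun _ => hW.map _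

theorem rowSpan_span {κ : Type*} (y : κ → E ⊗[K] R) :
    rowSpan A (Submodule.span R (Set.range y)) =
      Submodule.span R (Set.range fun q : Fin n × κ => rowMul (A q.1) (y q.2)) := by
  simp only [rowSpan, Submodule.map_span, ← Set.range_comp, ← Submodule.span_iUnion]
  congr 1
  ext x
  simp

/-- Right multiplication by `A` as a left `R`-linear map. -/
def vecMulLin : (Fin n → E ⊗[K] R) →ₗ[R] Fin m → E ⊗[K] R where
  toFun x := Matrix.vecMul x A
  map_add' x y := Matrix.add_vecMul _ _ _
  map_smul' r x := by
    ext j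
    simp [Matrix.vecMul, dotProduct, Finset.smul_sum, smul_mul_assoc]

theorem vecMulLin_eq (x : Fin n → E ⊗[K] R) : vecMulLin A x = ∑ i, rowMul (A i) (x i) := by
  ext j
  simp [vecMulLin, Matrix.vecMul, dotProduct, rowMul]

theorem map_vecMulLin (W : Submodule R (E ⊗[K] R)) :
    (Submodule.pi Set.univ fun _ => W).map (vecMulLin A) = rowSpan A W := by
  classical
  apply le_antisymm
  · rintro _ ⟨x, hx, rfl⟩
    rw [vecMulLin_eq]
    exact Submodule.sum_mem _ fun i _ => Submodule.mem_iSup_of_mem i ⟨x i, hx i trivial, rfl⟩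
  · refine iSup_le fun i => ?_
    rintro _ ⟨x, hx, rfl⟩
    refine ⟨Pi.single i x, fun j _ => ?_, ?_⟩
    · by_cases h : j = i
      · subst h; simpa using hx
      · simp [h]
    · rw [vecMulLin_eq, Finset.sum_eq_single i]
      · simp
      · intro j _ h
        simp [h]
      · simp

theorem rowSpan_mul {l : ℕ} (B : Matrix (Fin m) (Fin l) (E ⊗[K] R)) (W : Submodule R (E ⊗[K] R)) :
    rowSpan (A * B) W = (rowSpan A W).map (vecMulLin B) := by
  rw [rowSpan, rowSpan, Submodule.map_iSup]
  congr 1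
  ext1 i
  rw [← Submodule.map_comp]
  congr 1
  ext x j
  simp [vecMulLin, rowMul, Matrix.mul_apply, Matrix.vecMul, dotProduct, Finset.mul_sum, mul_assoc]

theorem rowSpan_mul_le {l : ℕ} (B : Matrix (Fin m) (Fin l) (E ⊗[K] R))
    {W W' : Submodule R (E ⊗[K] R)} (h : ∀ i j, ∀ y ∈ W, y * A i j ∈ W') :
    rowSpan (A * B) W ≤ rowSpan B W' := by
  rw [rowSpan_mul, ← map_vecMulLin B]
  refine Submodule.map_mono (iSup_le fun i => ?_)
  rintro _ ⟨x, hx, rfl⟩ j _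
  exact h i j x hx

/-- The matrix of right multiplication by `A`, from tuples in the span of the family `z` to tuples
in the module on which `p` takes coordinates. -/
def blockMatrix {ι κ ι' κ' : Type*} (z : ι → E ⊗[K] R) (p : E ⊗[K] R →ₗ[R] κ → R)
    (A : Matrix ι' κ' (E ⊗[K] R)) : Matrix (ι' × ι) (κ' × κ) R :=
  Matrix.of fun s t => p (z s.2 * A s.1 t.1) t.2

/-- In coordinates, the rank of the image of `A` is the rank of its block matrix. -/
theorem spanRank_rowSpan_eq_rank {ι κ : Type*} [Fintype ι] [Fintype κ] [DecidableEq κ]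
    (z : ι → E ⊗[K] R) {y : κ → E ⊗[K] R} {p : E ⊗[K] R →ₗ[R] κ → R} (hp : IsSplit p y)
    (h : ∀ a i j, z a * A i j ∈ Submodule.span R (Set.range y)) :
    rk.spanRank (rowSpan A (Submodule.span R (Set.range z))) = rk.rank (blockMatrix z p A) := by
  rw [rowSpan_span, rk.spanRank_span_eq_coord (hp.pi m)]
  · rfl
  · intro q
    exact mem_span_single y fun j => h q.2 q.1 j

theorem rank_blockMatrix_fromBlocks {ι κ : Type*} [Fintype ι] [Fintype κ] (z : ι → E ⊗[K] R)
    (p : E ⊗[K] R →ₗ[R] κ → R) {k l : ℕ} (C : Matrix (Fin n) (Fin l) (E ⊗[K] R))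
    (D : Matrix (Fin k) (Fin m) (E ⊗[K] R)) (B : Matrix (Fin k) (Fin l) (E ⊗[K] R)) :
    rk.rank (blockMatrix z p
        (Matrix.reindex finSumFinEquiv finSumFinEquiv (Matrix.fromBlocks A C D B))) =
      rk.rank (Matrix.fromBlocks (blockMatrix z p A) (blockMatrix z p C) (blockMatrix z p D)
        (blockMatrix z p B)) := by
  rw [← rk.rank_submatrix_equiv (Matrix.fromBlocks _ _ _ _)
    ((finSumFinEquiv.symm.prodCongr (Equiv.refl ι)).trans (Equiv.sumProdDistrib _ _ ι))
    ((finSumFinEquiv.symm.prodCongr (Equiv.refl κ)).trans (Equiv.sumProdDistrib _ _ κ))]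
  congr 1
  ext ⟨i, a⟩ ⟨j, b⟩
  obtain ⟨i, rfl⟩ := finSumFinEquiv.surjective i
  obtain ⟨j, rfl⟩ := finSumFinEquiv.surjective j
  rcases i with i | i <;> rcases j with j | j <;> simp [blockMatrix]

theorem blockMatrix_zero {ι κ ι' κ' : Type*} (z : ι → E ⊗[K] R) (p : E ⊗[K] R →ₗ[R] κ → R) :
    blockMatrix z p (0 : Matrix ι' κ' (E ⊗[K] R)) = 0 := by
  ext
  simp [blockMatrix]

theorem exists_tens_mul_mem (V : Submodule K E) [FiniteDimensional K V] :
    ∃ V' : Submodule K E, FiniteDimensional K V' ∧ V' ≠ ⊥ ∧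
      ∀ i j, ∀ y ∈ tens R V, y * A i j ∈ tens R V' := by
  obtain ⟨L, hL, h⟩ := exists_subset_tens (Set.range fun q : Fin n × Fin m => A q.1 q.2)
    (Set.finite_range _)
  have : FiniteDimensional K (V * L : Submodule K E) :=
    Module.Finite.iff_fg.2 ((Module.Finite.iff_fg.1 inferInstance).mul (Module.Finite.iff_fg.1 hL))
  refine ⟨V * L ⊔ K ∙ (1 : E), inferInstance, ?_, fun i j y hy =>
    mul_mem_tens le_sup_left hy (h ⟨(i, j), rfl⟩)⟩
  rw [Ne, Submodule.eq_bot_iff]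
  push Not
  exact ⟨1, Submodule.mem_sup_right (Submodule.mem_span_singleton_self 1), one_ne_zero⟩

theorem tens_ne_bot [Nontrivial R] {V : Submodule K E} : tens R V ≠ ⊥ ↔ V ≠ ⊥ := by
  rw [ne_eq, ne_eq, ← tens_bot (R := R) (K := K) (E := E), le_antisymm_iff, le_antisymm_iff,
    tens_le_tens_iff, tens_le_tens_iff]

/-- All choices in the definition of `rankAt` yield the rank of the submodule `W ^ n A`. -/
theorem rankAt_tens (V : Submodule K E) [FiniteDimensional K V] :
    rankAt rk (fieldSystem K E R) (tens R V) A = rk.spanRank (rowSpan A (tens R V)) := by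
  have := rk.nontrivial
  suffices h : {x : ℝ | ∃ (W' : NonzeroMem (fieldSystem K E R)) (l p : ℕ)
      (e : Module.Basis (Fin l) R (Fin n → tens R V))
      (e' : Module.Basis (Fin p) R (Fin m → W'.1)) (B : Matrix (Fin l) (Fin p) R),
      (∀ i j, ∀ y ∈ tens R V, y * A i j ∈ W'.1) ∧
      (∀ k, Matrix.vecMul (fun i => (e k i : E ⊗[K] R)) A =
        ∑ q, B k q • fun j => (e' q j : E ⊗[K] R)) ∧
      x = rk.rk B} = {rk.spanRank (rowSpan A (tens R V))} by
    rw [rankAt, h, csInf_singleton]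
  have hspan {l : ℕ} (e : Module.Basis (Fin l) R (Fin n → tens R V)) :
      Submodule.span R (Set.range fun k => Matrix.vecMul (fun i => (e k i : E ⊗[K] R)) A) =
        rowSpan A (tens R V) := by
    let c : (Fin n → tens R V) →ₗ[R] Fin n → E ⊗[K] R :=
      LinearMap.pi fun i => (tens R V).subtype ∘ₗ LinearMap.proj i
    have hc : (⊤ : Submodule R (Fin n → tens R V)).map c =
        Submodule.pi Set.univ fun _ => tens R V := by
      ext x
      constructor
      · rintro ⟨y, -, rfl⟩ i _
        exact (y i).2
      · intro hx
        exact ⟨fun i => ⟨x i, hx i trivial⟩, trivial, rfl⟩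
    rw [← map_vecMulLin, ← hc, ← e.span_eq, Submodule.map_span, Submodule.map_span,
      ← Set.range_comp, ← Set.range_comp]
    rfl
  apply Set.eq_singleton_iff_nonempty_unique_mem.2 ⟨?_, ?_⟩
  · obtain ⟨V', hV', h0, h⟩ := exists_tens_mul_mem A V
    obtain ⟨b⟩ := nonempty_basis_tens (R := R) V
    obtain ⟨b'⟩ := nonempty_basis_tens (R := R) V'
    let e := (Pi.basis fun _ : Fin n => b).reindex (Fintype.equivFin _)
    let e' := (Pi.basis fun _ : Fin m => b').reindex (Fintype.equivFin _)
    let x (k) : Fin m → tens R V' := fun j => ⟨Matrix.vecMul (fun i => (e k i : E ⊗[K] R)) A j,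
      by
      rw [Matrix.vecMul, dotProduct]
      exact Submodule.sum_mem _ fun i _ => h i j _ (e k i).2⟩
    refine ⟨_, ⟨tens R V', ⟨V', hV', rfl⟩, tens_ne_bot.2 h0⟩, _, _, e, e',
      Matrix.of fun k => e'.repr (x k), h, fun k => ?_, rfl⟩
    ext j
    have := congrArg (fun y : Fin m → tens R V' => (y j : E ⊗[K] R)) (e'.sum_repr (x k))
    simpa [x, Finset.sum_apply] using this.symm
  · rintro _ ⟨⟨W', ⟨V', hV', rfl⟩, h0⟩, l, p, e, e', B, h, hB, rfl⟩
    obtain ⟨q, hq⟩ := exists_isSplit_of_basis (R := R) (V := V') e'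
    rw [← hspan e, ← rank_fin, ← rk.spanRank_span_eq hq B]
    congr 3
    ext1 k
    exact (hB k).symm

end FieldTensor

/-! ### Translation invariant submodular functions on subspaces of `K[t]` -/

section DegreeFiltration

variable {K : Type u} [Field K]

open Polynomial

theorem finrank_degreeLT (k : ℕ) : Module.finrank K (degreeLT K k) = k := by
  rw [(degreeLTEquiv K k).finrank_eq]
  simp

theorem mem_degreeLT_iff_coeff {k : ℕ} {p : K[X]} :
    p ∈ degreeLT K k ↔ ∀ i, k ≤ i → p.coeff i = 0 := by
  rw [mem_degreeLT, degree_lt_iff_coeff_zero]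

theorem coeff_ne_zero_of_notMem {N : ℕ} {v : K[X]} (hv : v ∈ degreeLT K (N + 1))
    (hv' : v ∉ degreeLT K N) : v.coeff N ≠ 0 := by
  intro h
  refine hv' (mem_degreeLT_iff_coeff.2 fun i hi => ?_)
  rcases hi.eq_or_lt with rfl | hi
  · exact h
  · exact mem_degreeLT_iff_coeff.1 hv i hi

theorem inf_degreeLT_sup_span {V : Submodule K K[X]} {N : ℕ} (hV : V ≤ degreeLT K (N + 1))
    {v : K[X]} (hv : v ∈ V) (hv' : v ∉ degreeLT K N) : V ⊓ degreeLT K N ⊔ K ∙ v = V := by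
  have h0 := coeff_ne_zero_of_notMem (hV hv) hv'
  apply le_antisymm
  · exact sup_le inf_le_left ((Submodule.span_singleton_le_iff_mem _ _).2 hv)
  · intro x hx
    rw [← sub_add_cancel x ((x.coeff N / v.coeff N) • v)]
    refine add_mem (Submodule.mem_sup_left ⟨sub_mem hx (V.smul_mem _ hv), ?_⟩)
      (Submodule.mem_sup_right (Submodule.smul_mem _ _ (Submodule.mem_span_singleton_self v)))
    refine mem_degreeLT_iff_coeff.2 fun i hi => ?_
    rcases hi.eq_or_lt with rfl | hi
    · simp [h0]
    · simp [mem_degreeLT_iff_coeff.1 (hV hx) i hi, mem_degreeLT_iff_coeff.1 (hV hv) i hi]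

theorem degreeLT_sup_span {N : ℕ} {v : K[X]} (hv : v ∈ degreeLT K (N + 1))
    (hv' : v ∉ degreeLT K N) : degreeLT K N ⊔ K ∙ v = degreeLT K (N + 1) := by
  have := inf_degreeLT_sup_span le_rfl hv hv'
  rwa [inf_eq_right.2 (degreeLT_mono (Nat.le_succ N))] at this

theorem finrank_inf_degreeLT {V : Submodule K K[X]} {N : ℕ} (hV : V ≤ degreeLT K (N + 1))
    {v : K[X]} (hv : v ∈ V) (hv' : v ∉ degreeLT K N) :
    Module.finrank K V = Module.finrank K (V ⊓ degreeLT K N : Submodule K K[X]) + 1 := by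
  have h := Submodule.finrank_sup_add_finrank_inf_eq (V ⊓ degreeLT K N) (K ∙ v)
  have hv0 : v ≠ 0 := by
    rintro rfl
    exact hv' (zero_mem _)
  have hd : V ⊓ degreeLT K N ⊓ K ∙ v = ⊥ := by
    rw [Submodule.eq_bot_iff]
    rintro x ⟨⟨-, hx⟩, hx'⟩
    obtain ⟨c, rfl⟩ := Submodule.mem_span_singleton.1 hx'
    by_contra hc
    refine hv' (((degreeLT K N).smul_mem_iff ?_).1 hx)
    rintro rfl
    simp at hc
  rw [inf_degreeLT_sup_span hV hv hv', hd, finrank_bot, finrank_span_singleton hv0] at h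
  omega

theorem X_pow_mem_degreeLT (N : ℕ) : (X : K[X]) ^ N ∈ degreeLT K (N + 1) := by
  rw [mem_degreeLT, degree_X_pow]
  exact_mod_cast Nat.lt_succ_self N

theorem X_pow_notMem_degreeLT (N : ℕ) : (X : K[X]) ^ N ∉ degreeLT K N := by
  rw [mem_degreeLT, degree_X_pow]
  exact lt_irrefl _

theorem exists_le_degreeLT (V : Submodule K K[X]) [FiniteDimensional K V] :
    ∃ N, V ≤ degreeLT K N := by
  obtain ⟨s, rfl⟩ := Module.Finite.iff_fg.1 (inferInstance : FiniteDimensional K V)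
  obtain ⟨N, hN⟩ := (s.image natDegree).exists_nat_subset_range
  refine ⟨N, Submodule.span_le.2 fun p hp => mem_degreeLT.2 ?_⟩
  refine degree_le_natDegree.trans_lt ?_
  exact_mod_cast Finset.mem_range.1 (hN (Finset.mem_image_of_mem _ hp))

/-- A submodular, translation invariant real valued function on the finite dimensional subspaces
of `K[X]` whose increments in the direction of a single vector are at most `n`. -/
structure IsTranslationInvariantRank (φ : Submodule K K[X] → ℝ) (n : ℝ) : Prop where
  bot : φ ⊥ = 0
  mono : ∀ (U V : Submodule K K[X]) [FiniteDimensional K V], U ≤ V → φ U ≤ φ V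
  submodular : ∀ (U V : Submodule K K[X]) [FiniteDimensional K V], U ≤ V → ∀ x,
    φ (V ⊔ K ∙ x) + φ U ≤ φ (U ⊔ K ∙ x) + φ V
  increment : ∀ (V : Submodule K K[X]) [FiniteDimensional K V] (x : K[X]),
    φ (V ⊔ K ∙ x) ≤ φ V + n
  map_mul : ∀ (V : Submodule K K[X]) [FiniteDimensional K V] (q : K[X]), q ≠ 0 →
    φ (V.map (LinearMap.mulLeft K q)) = φ V

/-- The rank of the polynomials of degree `k` relative to those of smaller degree. -/
def degreeIncrement (φ : Submodule K K[X] → ℝ) (k : ℕ) : ℝ :=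
  φ (degreeLT K (k + 1)) - φ (degreeLT K k)

namespace IsTranslationInvariantRank

variable {φ : Submodule K K[X] → ℝ} {n : ℝ} (hφ : IsTranslationInvariantRank φ n)
include hφ

theorem degreeIncrement_nonneg (k : ℕ) : 0 ≤ degreeIncrement φ k :=
  sub_nonneg.2 (hφ.mono _ _ (degreeLT_mono (Nat.le_succ k)))

theorem map_mul_sup_span (U : Submodule K K[X]) [FiniteDimensional K U] {q x : K[X]} (hq : q ≠ 0) :
    φ (U.map (LinearMap.mulLeft K q) ⊔ K ∙ (q * x)) = φ (U ⊔ K ∙ x) := by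
  rw [← hφ.map_mul (U ⊔ K ∙ x) q hq, Submodule.map_sup, Submodule.map_span, Set.image_singleton]
  rfl

/-- Translate by `X`: the increment for `X ^ (k + 1)` is taken over a larger space than the one
for the translate of `X ^ k`. -/
theorem degreeIncrement_antitone : Antitone (degreeIncrement φ) := by
  refine antitone_nat_of_succ_le fun k => ?_
  have hle : (degreeLT K k).map (LinearMap.mulLeft K X) ≤ degreeLT K (k + 1) := by
    rintro _ ⟨p, hp, rfl⟩
    refine mem_degreeLT_iff_coeff.2 fun i hi => ?_
    obtain ⟨i, rfl⟩ : ∃ j, i = j + 1 := ⟨i - 1, by omega⟩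
    simpa using mem_degreeLT_iff_coeff.1 hp i (by omega)
  have h := hφ.submodular _ _ hle (X * X ^ k)
  rw [hφ.map_mul_sup_span _ X_ne_zero, hφ.map_mul _ _ X_ne_zero, ← pow_succ',
    degreeLT_sup_span (X_pow_mem_degreeLT _) (X_pow_notMem_degreeLT _),
    degreeLT_sup_span (X_pow_mem_degreeLT _) (X_pow_notMem_degreeLT _)] at h
  simp only [degreeIncrement]
  linarith

theorem exists_tendsto_degreeIncrement :
    ∃ c, 0 ≤ c ∧ Tendsto (degreeIncrement φ) atTop (𝓝 c) ∧ ∀ k, c ≤ degreeIncrement φ k := by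
  have hb : BddBelow (Set.range (degreeIncrement φ)) :=
    ⟨0, by rintro _ ⟨k, rfl⟩; exact hφ.degreeIncrement_nonneg k⟩
  exact ⟨_, le_ciInf hφ.degreeIncrement_nonneg,
    tendsto_atTop_ciInf hφ.degreeIncrement_antitone hb, fun k => ciInf_le hb k⟩

theorem sum_degreeIncrement (N : ℕ) :
    φ (degreeLT K N) = ∑ i ∈ Finset.range N, degreeIncrement φ i := by
  have h0 : degreeLT K 0 = ⊥ := by
    rw [Submodule.eq_bot_iff]
    intro p hp
    ext i
    simpa using mem_degreeLT_iff_coeff.1 hp i (Nat.zero_le i)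
  simp only [degreeIncrement]
  rw [Finset.sum_range_sub (fun i => φ (degreeLT K i)), h0, hφ.bot, sub_zero]

theorem tendsto_degreeLT_div {c : ℝ} (hc : Tendsto (degreeIncrement φ) atTop (𝓝 c)) :
    Tendsto (fun N : ℕ => φ (degreeLT K N) / N) atTop (𝓝 c) := by
  refine hc.cesaro.congr fun N => ?_
  rw [hφ.sum_degreeIncrement, div_eq_inv_mul]

/-- The lower bound holds for every subspace `V`: adding a basis vector of degree `N` increases the
rank over `V ∩ K[X]_{< N}` by no less than over all of `K[X]_{< N}`. -/
theorem mul_finrank_le {c : ℝ} (hc : ∀ k, c ≤ degreeIncrement φ k) (V : Submodule K K[X])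
    [FiniteDimensional K V] : c * Module.finrank K V ≤ φ V := by
  obtain ⟨N, hN⟩ := exists_le_degreeLT V
  induction N generalizing V with
  | zero =>
    have : V = ⊥ := by
      rw [Submodule.eq_bot_iff]
      intro p hp
      ext i
      simpa using mem_degreeLT_iff_coeff.1 (hN hp) i (Nat.zero_le i)
    subst this
    simp [hφ.bot]
  | succ N ih =>
    by_cases h : V ≤ degreeLT K N
    · exact ih V h
    · obtain ⟨v, hv, hv'⟩ := SetLike.not_le_iff_exists.1 h
      have h1 := ih (V ⊓ degreeLT K N) inf_le_right
      have h2 := hφ.submodular (V ⊓ degreeLT K N) (degreeLT K N) inf_le_right v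
      rw [inf_degreeLT_sup_span hN hv hv', degreeLT_sup_span (hN hv) hv'] at h2
      have h3 := hc N
      rw [degreeIncrement] at h3
      rw [finrank_inf_degreeLT hN hv hv']
      push_cast
      linarith

/-- The upper bound: a basis vector `X ^ k * u` of `V` of degree `N` for which `V` contains all the
`X ^ i * u` with `i ≤ k` increases the rank by at most `degreeIncrement φ k`. -/
theorem le_of_shifts {k : ℕ} (V U : Submodule K K[X]) [FiniteDimensional K V]
    (hU : ∀ x ∈ U, ∃ u, x = X ^ k * u ∧ ∀ p ∈ degreeLT K (k + 1), p * u ∈ V) :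
    φ V ≤ degreeIncrement φ k * Module.finrank K U +
      n * (Module.finrank K V - Module.finrank K U) := by
  have hUV : U ≤ V := by
    intro x hx
    obtain ⟨u, rfl, h⟩ := hU x hx
    exact h _ (X_pow_mem_degreeLT k)
  obtain ⟨N, hN⟩ := exists_le_degreeLT V
  induction N generalizing V U with
  | zero =>
    have : V = ⊥ := by
      rw [Submodule.eq_bot_iff]
      intro p hp
      ext i
      simpa using mem_degreeLT_iff_coeff.1 (hN hp) i (Nat.zero_le i)
    subst this
    rw [le_bot_iff.1 hUV]
    simp [hφ.bot]
  | succ N ih =>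
    have : FiniteDimensional K U := Submodule.finiteDimensional_of_le hUV
    by_cases hV : V ≤ degreeLT K N
    · exact ih V U hU hUV hV
    have hU' : ∀ x ∈ U ⊓ degreeLT K N, ∃ u, x = X ^ k * u ∧
        ∀ p ∈ degreeLT K (k + 1), p * u ∈ V ⊓ degreeLT K N := by
      rintro x ⟨hx, hxN⟩
      obtain ⟨u, rfl, h⟩ := hU x hx
      refine ⟨u, rfl, fun p hp => ⟨h p hp, ?_⟩⟩
      refine mem_degreeLT.2 (lt_of_le_of_lt ?_ (mem_degreeLT.1 hxN))
      rw [degree_mul, degree_mul, degree_X_pow]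
      refine add_le_add_left ?_ _
      exact (degree_le_iff_coeff_zero _ _).2 fun i hi =>
        mem_degreeLT_iff_coeff.1 hp i (Nat.succ_le_of_lt (by exact_mod_cast hi))
    have h1 := ih (V ⊓ degreeLT K N) (U ⊓ degreeLT K N) hU'
      (inf_le_inf_right _ hUV) inf_le_right
    by_cases h : U ≤ degreeLT K N
    · obtain ⟨v, hv, hv'⟩ := SetLike.not_le_iff_exists.1 hV
      rw [inf_eq_left.2 h] at h1
      have h2 := hφ.increment (V ⊓ degreeLT K N) v
      rw [inf_degreeLT_sup_span hN hv hv'] at h2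
      rw [finrank_inf_degreeLT hN hv hv']
      push_cast
      linarith
    · obtain ⟨v, hv, hv'⟩ := SetLike.not_le_iff_exists.1 h
      rw [finrank_inf_degreeLT hN (hUV hv) hv', finrank_inf_degreeLT (hUV.trans hN) hv hv']
      obtain ⟨u, rfl, hu⟩ := hU v hv
      have hu0 : u ≠ 0 := by
        rintro rfl
        simp at hv'
      have hle : (degreeLT K k).map (LinearMap.mulLeft K u) ≤ V ⊓ degreeLT K N := by
        rintro _ ⟨p, hp, rfl⟩
        have hp1 := degreeLT_mono (Nat.le_succ k) hp
        rw [LinearMap.mulLeft_apply, mul_comm]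
        refine ⟨hu p hp1, ?_⟩
        have hp : p.degree < k := mem_degreeLT.1 hp
        have hd : (X ^ k * u).degree < ↑(N + 1) := mem_degreeLT.1 (hN (hUV hv))
        rw [SetLike.mem_coe, mem_degreeLT]
        rw [degree_mul, degree_eq_natDegree hu0] at hd ⊢
        rw [degree_X_pow] at hd
        rcases eq_or_ne p 0 with rfl | hp0
        · simp
        rw [degree_eq_natDegree hp0] at hp ⊢
        norm_cast at hp hd ⊢
        omega
      have h2 := hφ.submodular _ _ hle (u * X ^ k)
      rw [hφ.map_mul_sup_span _ hu0, hφ.map_mul _ _ hu0,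
        degreeLT_sup_span (X_pow_mem_degreeLT _) (X_pow_notMem_degreeLT _), mul_comm u,
        inf_degreeLT_sup_span hN (hUV hv) hv'] at h2
      simp only [degreeIncrement] at h1 ⊢
      push_cast
      linarith

end IsTranslationInvariantRank

end DegreeFiltration

/-! ### Normalized ranks of almost invariant subspaces of `K(t)` -/

namespace FieldTensor

section ImageRank

variable {K : Type u} [Field K] {E : Type w} [Field E] [Algebra K E] {R : Type v} [Ring R]
  [Algebra K R] (rk : SylvesterMatrixRank R) {n m : ℕ} (A : Matrix (Fin n) (Fin m) (E ⊗[K] R))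

/-- The rank of right multiplication by `A` on `(V ⊗ R) ^ n`. -/
def imageRank (V : Submodule K E) : ℝ := rk.spanRank (rowSpan A (tens R V))

theorem rowSpan_tens_fg (V : Submodule K E) [FiniteDimensional K V] :
    (rowSpan A (tens R V)).FG := rowSpan_fg A (tens_fg V)

theorem imageRank_nonneg (V : Submodule K E) : 0 ≤ imageRank rk A V := rk.spanRank_nonneg _

theorem imageRank_bot : imageRank rk A ⊥ = 0 := by
  rw [imageRank, tens_bot, rowSpan_bot, rk.spanRank_bot]

theorem imageRank_mono {U V : Submodule K E} [FiniteDimensional K V] (h : U ≤ V) :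
    imageRank rk A U ≤ imageRank rk A V :=
  rk.spanRank_mono (rowSpan_tens_fg A V) (rowSpan_mono A (tens_mono h))

theorem imageRank_sup_add_le {U V W : Submodule K E} [FiniteDimensional K V]
    [FiniteDimensional K W] (hV : U ≤ V) (hW : U ≤ W) :
    imageRank rk A (V ⊔ W) + imageRank rk A U ≤ imageRank rk A V + imageRank rk A W := by
  have : FiniteDimensional K U := Submodule.finiteDimensional_of_le hV
  rw [imageRank, tens_sup, rowSpan_sup]
  exact rk.spanRank_sup_add_le ((locallySplit K E R).pi m) (rowSpan_tens_fg A V)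
    (rowSpan_tens_fg A W) (rowSpan_tens_fg A U) (rowSpan_mono A (tens_mono hV))
    (rowSpan_mono A (tens_mono hW))

theorem imageRank_le (V : Submodule K E) [FiniteDimensional K V] :
    imageRank rk A V ≤ n * Module.finrank K V := by
  rw [imageRank, tens_eq_span_basis (Module.finBasis K V), rowSpan_span]
  refine (rk.spanRank_span_le _).trans (le_of_eq ?_)
  simp

theorem imageRank_sup_le (V W : Submodule K E) [FiniteDimensional K V] [FiniteDimensional K W] :
    imageRank rk A (V ⊔ W) ≤ imageRank rk A V + n * Module.finrank K W := by
  have := imageRank_sup_add_le rk A (bot_le : ⊥ ≤ V) (bot_le : ⊥ ≤ W)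
  rw [imageRank_bot, add_zero] at this
  exact this.trans (by gcongr; exact imageRank_le rk A W)

theorem imageRank_le_add_of_le {V W : Submodule K E} [FiniteDimensional K W] (h : V ≤ W) :
    imageRank rk A W ≤
      imageRank rk A V + n * ((Module.finrank K W : ℝ) - Module.finrank K V) := by
  obtain ⟨C, hC⟩ := Submodule.exists_isCompl (V.comap W.subtype)
  have hV : FiniteDimensional K V := Submodule.finiteDimensional_of_le h
  have h1 : V ⊔ C.map W.subtype = W := by
    have := congrArg (Submodule.map W.subtype) hC.sup_eq_top
    rwa [Submodule.map_sup, Submodule.map_comap_subtype, Submodule.map_subtype_top,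
      inf_eq_right.2 h] at this
  have h2 := Submodule.finrank_add_eq_of_isCompl hC
  rw [LinearEquiv.finrank_eq (Submodule.comapSubtypeEquivOfLe h)] at h2
  have h3 := imageRank_sup_le rk A V (C.map W.subtype)
  rw [h1, Submodule.finrank_map_subtype_eq] at h3
  have h4 : (Module.finrank K C : ℝ) = (Module.finrank K W : ℝ) - Module.finrank K V := by
    rw [← h2]
    push_cast
    ring
  rwa [h4] at h3

/-- Left multiplication by the central element `q ⊗ 1`. -/
def mulLeftTensor (q : E) : E ⊗[K] R →ₗ[R] E ⊗[K] R where
  toFun x := (q ⊗ₜ[K] (1 : R)) * x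
  map_add' := mul_add _
  map_smul' r x := by
    rw [(commute_tmul_one q (r • x)).eq, smul_mul_assoc, ← (commute_tmul_one q x).eq]
    rfl

theorem map_mulLeftTensor (q : E) (V : Submodule K E) :
    (tens R V).map (mulLeftTensor q) = tens R (V.map (LinearMap.mulLeft K q)) := by
  rw [tens, tens, Submodule.map_span, ← Set.image_comp, Submodule.map_coe, ← Set.image_comp]
  congr 2
  ext v
  simp [mulLeftTensor]

theorem imageRank_map_mul_le (q : E) (V : Submodule K E) [FiniteDimensional K V] :
    imageRank rk A (V.map (LinearMap.mulLeft K q)) ≤ imageRank rk A V := by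
  have h : rowSpan A (tens R (V.map (LinearMap.mulLeft K q))) =
      (rowSpan A (tens R V)).map ((mulLeftTensor q).compLeft (Fin m)) := by
    rw [← map_mulLeftTensor, rowSpan, rowSpan, Submodule.map_iSup]
    congr 1
    ext1 i
    rw [← Submodule.map_comp, ← Submodule.map_comp]
    congr 1
    ext x j
    simp [mulLeftTensor, rowMul, mul_assoc]
  rw [imageRank, h]
  exact rk.spanRank_map_le (rowSpan_tens_fg A V) _

theorem imageRank_map_mul {q : E} (hq : q ≠ 0) (V : Submodule K E) [FiniteDimensional K V] :
    imageRank rk A (V.map (LinearMap.mulLeft K q)) = imageRank rk A V := by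
  refine le_antisymm (imageRank_map_mul_le rk A q V) ?_
  have := imageRank_map_mul_le rk A q⁻¹ (V.map (LinearMap.mulLeft K q))
  rw [← Submodule.map_comp, ← LinearMap.mulLeft_mul, inv_mul_cancel₀ hq, LinearMap.mulLeft_one,
    Submodule.map_id] at this
  exact this

end ImageRank

section RationalFunctions

variable {K : Type u} [Field K] {R : Type v} [Ring R] [Algebra K R]

variable (K) in
/-- The inclusion of `K[t]` in `K(t)`, as a `K`-linear map. -/
def ratIncl : K[X] →ₗ[K] RatFunc K := (IsScalarTower.toAlgHom K K[X] (RatFunc K)).toLinearMap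

theorem ratIncl_apply (p : K[X]) : ratIncl K p = algebraMap K[X] (RatFunc K) p := rfl

theorem ratIncl_injective : Function.Injective (ratIncl K) := RatFunc.algebraMap_injective K

theorem ratIncl_ne_zero {q : K[X]} (hq : q ≠ 0) : ratIncl K q ≠ 0 := by
  rw [← map_zero (ratIncl K)]
  exact ratIncl_injective.ne hq

theorem map_ratIncl_mul (V : Submodule K K[X]) (q : K[X]) :
    (V.map (LinearMap.mulLeft K q)).map (ratIncl K) =
      (V.map (ratIncl K)).map (LinearMap.mulLeft K (ratIncl K q)) := by
  rw [← Submodule.map_comp, ← Submodule.map_comp]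
  congr 1
  refine LinearMap.ext fun p => ?_
  simp [ratIncl_apply]

theorem finrank_map_ratIncl (V : Submodule K K[X]) :
    Module.finrank K (V.map (ratIncl K)) = Module.finrank K V :=
  (LinearEquiv.finrank_eq (Submodule.equivMapOfInjective _ ratIncl_injective V)).symm

/-- Clearing denominators. -/
theorem exists_map_mul_eq_map_ratIncl (V : Submodule K (RatFunc K)) [FiniteDimensional K V] :
    ∃ q : K[X], q ≠ 0 ∧ ∃ V₁ : Submodule K K[X], FiniteDimensional K V₁ ∧
      V.map (LinearMap.mulLeft K (ratIncl K q)) = V₁.map (ratIncl K) := by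
  obtain ⟨s, rfl⟩ := Module.Finite.iff_fg.1 (inferInstance : FiniteDimensional K V)
  obtain ⟨q, hq⟩ := IsLocalization.exist_integer_multiples_of_finset (nonZeroDivisors K[X]) s
  refine ⟨q, nonZeroDivisors.coe_ne_zero q, ?_⟩
  choose! g hg using hq
  refine ⟨Submodule.span K (g '' s), FiniteDimensional.span_of_finite K (s.finite_toSet.image _), ?_⟩
  rw [Submodule.map_span, Submodule.map_span, ← Set.image_comp]
  congr 1
  refine Set.image_congr fun x hx => ?_
  rw [Function.comp_apply, ratIncl_apply, ratIncl_apply, hg x hx, LinearMap.mulLeft_apply]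
  exact (Algebra.smul_def _ _).symm

variable (rk : SylvesterMatrixRank R) {n m : ℕ} (A : Matrix (Fin n) (Fin m) (RatFunc K ⊗[K] R))

theorem isTranslationInvariantRank :
    IsTranslationInvariantRank (fun V : Submodule K K[X] => imageRank rk A (V.map (ratIncl K)))
      n where
  bot := by rw [Submodule.map_bot, imageRank_bot]
  mono U V _ h := imageRank_mono rk A (Submodule.map_mono h)
  submodular U V _ h x := by
    have : FiniteDimensional K U := Submodule.finiteDimensional_of_le h
    have h1 := imageRank_sup_add_le rk A (U := U.map (ratIncl K)) (V := V.map (ratIncl K))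
      (W := (U ⊔ K ∙ x).map (ratIncl K)) (Submodule.map_mono h) (Submodule.map_mono le_sup_left)
    rw [← Submodule.map_sup, ← sup_assoc, sup_eq_left.2 h] at h1
    linarith
  increment V _ x := by
    have h := imageRank_sup_le rk A (V.map (ratIncl K)) ((K ∙ x).map (ratIncl K))
    rw [← Submodule.map_sup] at h
    refine h.trans ?_
    have : Module.finrank K ((K ∙ x).map (ratIncl K)) ≤ 1 := by
      rw [finrank_map_ratIncl]
      simpa using finrank_span_le_card (R := K) ({x} : Set K[X])
    have : (n : ℝ) * Module.finrank K ((K ∙ x).map (ratIncl K)) ≤ n * 1 := by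
      gcongr
      exact_mod_cast this
    linarith
  map_mul V _ q hq := by
    rw [map_ratIncl_mul, imageRank_map_mul rk A (ratIncl_ne_zero hq)]

/-- Injectivity of `g` bounds the codimension of the part of `A` that `g` maps back to `V`. -/
theorem finrank_add_le_of_map_le {M : Type*} [AddCommGroup M] [Module K M] {A V V' : Submodule K M}
    [FiniteDimensional K V'] (hA : A ≤ V) (hV : V ≤ V') (g : M →ₗ[K] M)
    (hg : Function.Injective g) (h : V.map g ≤ V') :
    Module.finrank K A + Module.finrank K V ≤
      Module.finrank K (A ⊓ V.comap g : Submodule K M) + Module.finrank K V' := by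
  have : FiniteDimensional K V := Submodule.finiteDimensional_of_le hV
  have : FiniteDimensional K A := Submodule.finiteDimensional_of_le hA
  have h1 := Submodule.finrank_sup_add_finrank_inf_eq (A.map g) V
  have h2 : A.map g ⊓ V = (A ⊓ V.comap g).map g := by
    ext x
    constructor
    · rintro ⟨⟨a, ha, rfl⟩, hx⟩
      exact ⟨a, ⟨ha, hx⟩, rfl⟩
    · rintro ⟨a, ⟨ha, hx⟩, rfl⟩
      exact ⟨⟨a, ha, rfl⟩, hx⟩
  rw [h2, ← (Submodule.equivMapOfInjective g hg _).finrank_eq,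
    ← (Submodule.equivMapOfInjective g hg _).finrank_eq] at h1
  have h3 := Submodule.finrank_mono (sup_le ((Submodule.map_mono hA).trans h) hV)
  omega

open Polynomial in
/-- If `V` is almost invariant under `X, …, X ^ k`, most of `V` is mapped to `V` by all of them. -/
theorem exists_shift_core {V V' : Submodule K K[X]} [FiniteDimensional K V'] (hV : V ≤ V') (k : ℕ)
    (h : ∀ i ≤ k, ∀ v ∈ V, X ^ i * v ∈ V') :
    ∃ U ≤ V, (∀ i ≤ k, ∀ u ∈ U, X ^ i * u ∈ V) ∧
      (Module.finrank K V : ℝ) ≤ Module.finrank K U +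
        k * ((Module.finrank K V' : ℝ) - Module.finrank K V) := by
  induction k with
  | zero => exact ⟨V, le_rfl, fun i hi u hu => by simpa [Nat.le_zero.1 hi] using hu, by simp⟩
  | succ k ih =>
    obtain ⟨U, hU, h1, h2⟩ := ih fun i hi => h i (hi.trans (Nat.le_succ k))
    have h3 := finrank_add_le_of_map_le hU hV (LinearMap.mulLeft K (X ^ (k + 1)))
      (mul_right_injective₀ (pow_ne_zero _ X_ne_zero))
      (by rintro _ ⟨v, hv, rfl⟩; exact h _ le_rfl v hv)
    refine ⟨U ⊓ V.comap (LinearMap.mulLeft K (X ^ (k + 1))), inf_le_left.trans hU, fun i hi u hu => ?_, ?_⟩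
    · rcases hi.eq_or_lt with rfl | hi
      · exact hu.2
      · exact h1 i (Nat.le_of_lt_succ hi) u hu.1
    · have h3' : (Module.finrank K U : ℝ) + Module.finrank K V ≤
          Module.finrank K (U ⊓ V.comap (LinearMap.mulLeft K (X ^ (k + 1))) : Submodule K K[X]) +
            Module.finrank K V' := by exact_mod_cast h3
      push_cast
      linarith

open Polynomial in
/-- The normalized ranks `imageRank rk A V / dim V` are bounded below by a number to which they
converge along almost invariant `V`. -/
theorem exists_asymptotic_rank :
    ∃ c : ℝ, Tendsto (fun N : ℕ => imageRank rk A ((degreeLT K N).map (ratIncl K)) / N) atTop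
        (𝓝 c) ∧
      (∀ (V : Submodule K (RatFunc K)) [FiniteDimensional K V],
        c * Module.finrank K V ≤ imageRank rk A V) ∧
      ∀ δ : ℝ, 0 < δ → ∃ (k : ℕ) (ε : ℝ), 0 < ε ∧
        ∀ (V V' : Submodule K (RatFunc K)) [FiniteDimensional K V'], V ≤ V' →
          (∀ i ≤ k, ∀ v ∈ V, v * RatFunc.X ^ i ∈ V') →
          (Module.finrank K V' : ℝ) ≤ (1 + ε) * Module.finrank K V →
          imageRank rk A V ≤ (c + δ) * Module.finrank K V := by
  have hφ := isTranslationInvariantRank rk A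
  set φ : Submodule K K[X] → ℝ := fun V => imageRank rk A (V.map (ratIncl K))
  obtain ⟨c, hc0, hc, hle⟩ := hφ.exists_tendsto_degreeIncrement
  refine ⟨c, hφ.tendsto_degreeLT_div hc, fun V _ => ?_, fun δ hδ => ?_⟩
  · obtain ⟨q, hq, V₁, hV₁, h⟩ := exists_map_mul_eq_map_ratIncl V
    rw [← imageRank_map_mul rk A (ratIncl_ne_zero hq), h]
    have h1 := hφ.mul_finrank_le hle V₁
    rwa [← finrank_map_ratIncl, ← h, ← (Submodule.equivMapOfInjective _
      (mul_right_injective₀ (ratIncl_ne_zero hq) :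
        Function.Injective (LinearMap.mulLeft K (ratIncl K q))) V).finrank_eq] at h1
  · obtain ⟨k, hk⟩ := (hc.eventually (gt_mem_nhds (by linarith : c < c + δ / 2))).exists
    have hpos : (0 : ℝ) < n * k + 1 := by positivity
    refine ⟨k, δ / 2 / (n * k + 1), by positivity, fun V V' _ hVV' hX hdim => ?_⟩
    obtain ⟨q, hq, V₁', hV₁', hV'⟩ := exists_map_mul_eq_map_ratIncl V'
    have hinj : Function.Injective (LinearMap.mulLeft K (ratIncl K q)) :=
      mul_right_injective₀ (ratIncl_ne_zero hq)
    have : FiniteDimensional K V := Submodule.finiteDimensional_of_le hVV'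
    set V₁ := (V.map (LinearMap.mulLeft K (ratIncl K q))).comap (ratIncl K) with hV₁def
    have hV : V.map (LinearMap.mulLeft K (ratIncl K q)) = V₁.map (ratIncl K) := by
      rw [hV₁def, Submodule.map_comap_eq, inf_eq_right.2]
      exact (Submodule.map_mono hVV').trans (hV'.trans_le LinearMap.map_le_range)
    have hle' : V₁ ≤ V₁' := by
      rw [← Submodule.map_le_map_iff_of_injective (ratIncl_injective (K := K)), ← hV, ← hV']
      exact Submodule.map_mono hVV'
    have hd : Module.finrank K V = Module.finrank K V₁ := by
      rw [← finrank_map_ratIncl, ← hV, (Submodule.equivMapOfInjective _ hinj V).finrank_eq]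
    have hd' : Module.finrank K V' = Module.finrank K V₁' := by
      rw [← finrank_map_ratIncl, ← hV', (Submodule.equivMapOfInjective _ hinj V').finrank_eq]
    have hfd : FiniteDimensional K V₁ := Submodule.finiteDimensional_of_le hle'
    obtain ⟨U, hU, hUk, hUd⟩ := exists_shift_core hle' k (by
      rintro i hi v ⟨x, hx, hxv⟩
      have h1 : ratIncl K (X ^ i * v) ∈ V₁'.map (ratIncl K) := by
        rw [← hV']
        refine ⟨x * RatFunc.X ^ i, hX i hi x hx, ?_⟩
        simp only [LinearMap.mulLeft_apply, ratIncl_apply, map_mul, map_pow,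
          RatFunc.algebraMap_X] at hxv ⊢
        rw [← hxv]
        ring
      obtain ⟨y, hy, hyv⟩ := h1
      rwa [← ratIncl_injective hyv])
    have hXinj : Function.Injective (LinearMap.mulLeft K (X ^ k : K[X])) :=
      mul_right_injective₀ (pow_ne_zero _ X_ne_zero)
    have hmain := hφ.le_of_shifts (k := k) V₁ (U.map (LinearMap.mulLeft K (X ^ k))) (by
      rintro _ ⟨u, hu, rfl⟩
      refine ⟨u, rfl, fun p hp => ?_⟩
      rw [p.as_sum_range_C_mul_X_pow' (n := k + 1) ?_, Finset.sum_mul]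
      · refine Submodule.sum_mem _ fun i hi => ?_
        rw [mul_assoc, ← smul_eq_C_mul]
        exact V₁.smul_mem _ (hUk i (Nat.le_of_lt_succ (Finset.mem_range.1 hi)) u hu)
      · exact Nat.lt_succ_of_le (natDegree_le_iff_coeff_eq_zero.2 fun i hi =>
          mem_degreeLT_iff_coeff.1 hp i hi))
    rw [← (Submodule.equivMapOfInjective _ hXinj U).finrank_eq] at hmain
    rw [← imageRank_map_mul rk A (ratIncl_ne_zero hq), hV, hd]
    refine hmain.trans ?_
    rw [hd, hd'] at hdim
    have hUle : (Module.finrank K U : ℝ) ≤ Module.finrank K V₁ := by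
      exact_mod_cast Submodule.finrank_mono hU
    have h0 := hφ.degreeIncrement_nonneg k
    set a := (Module.finrank K V₁ : ℝ)
    set b := (Module.finrank K U : ℝ)
    set a' := (Module.finrank K V₁' : ℝ)
    have ha : 0 ≤ a := Nat.cast_nonneg _
    have e1 : degreeIncrement φ k * b ≤ (c + δ / 2) * a := by
      calc degreeIncrement φ k * b ≤ degreeIncrement φ k * a := by gcongr
        _ ≤ _ := by gcongr
    have e2 : (n : ℝ) * (a - b) ≤ δ / 2 * a := by
      have e3 : a - b ≤ k * (δ / 2 / (n * k + 1) * a) := by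
        have : (k : ℝ) * (a' - a) ≤ k * (δ / 2 / (n * k + 1) * a) := by
          gcongr
          linarith
        linarith
      calc (n : ℝ) * (a - b) ≤ n * (k * (δ / 2 / (n * k + 1) * a)) := by gcongr
        _ = (n * k / (n * k + 1)) * (δ / 2 * a) := by ring
        _ ≤ 1 * (δ / 2 * a) := by
          gcongr
          rw [div_le_one hpos]
          linarith
        _ = _ := one_mul _
    linarith

end RationalFunctions

end FieldTensor

/-! ### Quotients of `R[t]` by monic central polynomials -/

section PolynomialQuotient

open Polynomial SylvesterMatrixRank

variable {K : Type u} [Field K] {R : Type v} [Ring R] [Algebra K R]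

theorem eq_sum_coeff_smul_X_pow {d : ℕ} {p : R[X]} (hp : p ∈ degreeLT R d) :
    p = ∑ j : Fin d, p.coeff j • (X : R[X]) ^ (j : ℕ) := by
  rw [Fin.sum_univ_eq_sum_range (fun j => p.coeff j • (X : R[X]) ^ j) d]
  ext k
  simp only [finsetSum_coeff, coeff_smul, coeff_X_pow, smul_eq_mul, mul_ite, mul_one, mul_zero,
    Finset.sum_ite_eq, Finset.mem_range]
  split_ifs with hk
  · rfl
  · exact (degree_lt_iff_coeff_zero _ _).1 (mem_degreeLT.1 hp) k (not_lt.1 hk)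

/-- If the powers of `X` below degree `d` are split under `F`, then the rank of the span of vectors
of polynomials of degree less than `d` is that of their coefficient matrix, whatever `F` is. -/
theorem spanRank_eq_rank_coeff (rk : SylvesterMatrixRank R) {M : Type*} [AddCommGroup M]
    [Module R M] (F : R[X] →ₗ[R] M) {d : ℕ} {p : M →ₗ[R] Fin d → R}
    (hp : IsSplit p fun j : Fin d => F (X ^ (j : ℕ))) {ι : Type*} [Fintype ι] {m : ℕ}
    (x : ι → Fin m → R[X]) (hx : ∀ i s, x i s ∈ degreeLT R d) :
    rk.spanRank (Submodule.span R (Set.range fun i s => F (x i s))) =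
      rk.rank (Matrix.of fun i (q : Fin m × Fin d) => (x i q.1).coeff q.2) := by
  rw [← rk.spanRank_span_eq (hp.pi m)]
  congr 3
  ext1 i
  simp only [Matrix.of_apply]
  rw [sum_smul_single (fun s (j : Fin d) => (x i s).coeff j) fun j : Fin d => F (X ^ (j : ℕ))]
  ext1 s
  conv_lhs => rw [eq_sum_coeff_smul_X_pow (hx i s), map_sum]
  simp only [map_smul]

/-- The quotient map to `R[t] / R[t] f`, as an `R`-linear map. -/
def polyMk (R : Type v) [Ring R] [Algebra K R] (f : K[X]) : R[X] →ₗ[R] PolyQuot R f where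
  toFun := Ideal.Quotient.mk (polyIdeal R f)
  map_add' := map_add _
  map_smul' _ _ := rfl

theorem polyMk_apply (f : K[X]) (p : R[X]) : polyMk R f p = Ideal.Quotient.mk (polyIdeal R f) p :=
  rfl

theorem polyMk_surjective (f : K[X]) : Function.Surjective (polyMk R f) :=
  Ideal.Quotient.mk_surjective

/-- Division with remainder by the monic central polynomial `f`. -/
theorem exists_basis_polyQuot [Nontrivial R] {f : K[X]} (hf : f.Monic) :
    ∃ b : Module.Basis (Fin f.natDegree) R (PolyQuot R f), ∀ j, b j = polyMk R f (X ^ (j : ℕ)) := by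
  set g := f.map (algebraMap K R) with hg
  have hgm : g.Monic := hf.map _
  have hdeg : g.degree = f.natDegree := by
    rw [hf.degree_map, degree_eq_natDegree hf.ne_zero]
  have hker {p : R[X]} : polyMk R f p = 0 ↔ ∃ a, a * g = p := by
    rw [polyMk_apply, Ideal.Quotient.eq_zero_iff_mem, polyIdeal, Ideal.mem_span_singleton']
  have hli : LinearIndependent R fun j : Fin f.natDegree => polyMk R f (X ^ (j : ℕ)) := by
    rw [Fintype.linearIndependent_iff]
    intro c hc
    simp only [← map_smul, ← map_sum] at hc
    obtain ⟨a, ha⟩ := hker.1 hc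
    have hlt : (∑ j : Fin f.natDegree, c j • (X : R[X]) ^ (j : ℕ)).degree < f.natDegree := by
      rw [← mem_degreeLT]
      refine Submodule.sum_mem _ fun j _ => Submodule.smul_mem _ _ (mem_degreeLT.2 ?_)
      rw [degree_X_pow]
      exact_mod_cast j.2
    have ha0 : a = 0 := by
      by_contra h0
      rw [← ha, hgm.degree_mul, hdeg, degree_eq_natDegree h0] at hlt
      norm_cast at hlt
      omega
    rw [ha0, zero_mul] at ha
    intro i
    have := congrArg (fun p => coeff p (i : ℕ)) ha
    simpa [finsetSum_coeff, coeff_X_pow, Fin.val_inj] using this.symm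
  refine ⟨Module.Basis.mk hli ?_, fun j => Module.Basis.mk_apply _ _ _⟩
  rintro x -
  obtain ⟨p, rfl⟩ := polyMk_surjective f x
  have h1 : polyMk R f p = polyMk R f (p %ₘ g) := by
    rw [← sub_eq_zero, ← map_sub, hker]
    refine ⟨p /ₘ g, ?_⟩
    rw [← (commute_polyMap R f _).eq, eq_sub_iff_add_eq, add_comm]
    exact modByMonic_add_div p g
  have h2 : p %ₘ g ∈ degreeLT R f.natDegree := by
    rw [mem_degreeLT, ← hdeg]
    exact degree_modByMonic_lt p hgm
  rw [h1, eq_sum_coeff_smul_X_pow h2, map_sum]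
  refine Submodule.sum_mem _ fun i _ => ?_
  rw [map_smul]
  exact Submodule.smul_mem _ _ (Submodule.subset_span ⟨i, rfl⟩)

/-- The left `R`-linear map `x ↦ x a` to `(R[t] / R[t] f) ^ m`, for a row vector `a`. -/
def polyRowMul (f : K[X]) {m : ℕ} (a : Fin m → R[X]) : PolyQuot R f →ₗ[R] Fin m → PolyQuot R f where
  toFun x s := x * polyMk R f (a s)
  map_add' x y := by ext1 s; exact add_mul _ _ _
  map_smul' r x := by
    ext1 s
    obtain ⟨p, rfl⟩ := polyMk_surjective f x
    exact congrArg (polyMk R f) (smul_mul_assoc r p (a s))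

/-- The image of `(R[t] / R[t] f) ^ n` under right multiplication by `A`. -/
def polyRowSpan (f : K[X]) {n m : ℕ} (A : Matrix (Fin n) (Fin m) R[X]) :
    Submodule R (Fin m → PolyQuot R f) :=
  ⨆ i, LinearMap.range (polyRowMul f (A i))

variable {f : K[X]} {n m : ℕ} (A : Matrix (Fin n) (Fin m) R[X])

theorem polyRowSpan_eq {κ : Type*} {y : κ → PolyQuot R f}
    (hy : Submodule.span R (Set.range y) = ⊤) :
    polyRowSpan f A =
      Submodule.span R (Set.range fun q : Fin n × κ => polyRowMul f (A q.1) (y q.2)) := by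
  simp only [polyRowSpan, ← Submodule.map_top, ← hy, Submodule.map_span, ← Set.range_comp,
    ← Submodule.span_iUnion]
  congr 1
  ext x
  simp

theorem rk_psiMatrix (rk : SylvesterMatrixRank R) {d : ℕ}
    (b : Module.Basis (Fin d) R (PolyQuot R f)) :
    rk.rk (psiMatrix b A) = rk.spanRank (polyRowSpan f A) := by
  rw [polyRowSpan_eq A b.span_eq, rk.spanRank_span_eq_coord ((isSplit_basis b).pi m),
    rk.rank_eq_rk _ finProdFinEquiv.symm finProdFinEquiv.symm]
  · rfl
  · intro q
    refine mem_span_single b fun s => ?_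
    rw [b.span_eq]
    trivial

theorem rankPoly_eq (rk : SylvesterMatrixRank R) (hf : f.Monic) :
    rankPoly rk f A = rk.spanRank (polyRowSpan f A) / f.natDegree := by
  have := rk.nontrivial
  have : Nonempty (Module.Basis (Fin f.natDegree) R (PolyQuot R f)) :=
    ⟨(exists_basis_polyQuot hf).choose⟩
  simp only [rankPoly, rk_psiMatrix, ciInf_const]

theorem polyToTensor_C (r : R) : polyToTensor K R (C r) = (1 : RatFunc K) ⊗ₜ[K] r :=
  eval₂_C _ _

theorem polyToTensor_X : polyToTensor K R X = RatFunc.X ⊗ₜ[K] (1 : R) :=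
  eval₂_X _ _

variable (K R) in
/-- The embedding of `R[t]` in `K(t) ⊗ R` as an `R`-linear map. -/
def polyToTensorLin : R[X] →ₗ[R] RatFunc K ⊗[K] R where
  toFun := polyToTensor K R
  map_add' := map_add _
  map_smul' r p := by
    rw [smul_eq_C_mul, map_mul, RingHom.id_apply, FieldTensor.smul_def, polyToTensor_C]

theorem polyToTensorLin_apply (p : R[X]) : polyToTensorLin K R p = polyToTensor K R p := rfl

open FieldTensor

theorem polyToTensor_X_pow (j : ℕ) :
    polyToTensor K R (X ^ j) = ratIncl K (X ^ j) ⊗ₜ[K] (1 : R) := by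
  rw [map_pow, polyToTensor_X, Algebra.TensorProduct.tmul_pow, one_pow, ratIncl_apply, map_pow,
    RatFunc.algebraMap_X]

variable (K) in
/-- The basis of monomials of the polynomials of degree less than `d`, in `K(t)`. -/
def monomialBasis (d : ℕ) : Module.Basis (Fin d) K ((degreeLT K d).map (ratIncl K)) :=
  (degreeLT.basis K d).map (Submodule.equivMapOfInjective _ ratIncl_injective _)

theorem monomialBasis_apply {d : ℕ} (j : Fin d) :
    (monomialBasis K d j : RatFunc K) = ratIncl K (X ^ (j : ℕ)) := by
  simp [monomialBasis]

theorem rowSpan_degreeLT (d : ℕ) :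
    rowSpan (A.map (polyToTensor K R)) (tens R ((degreeLT K d).map (ratIncl K))) =
      Submodule.span R (Set.range fun (q : Fin n × Fin d) s =>
        polyToTensorLin K R (X ^ (q.2 : ℕ) * A q.1 s)) := by
  rw [tens_eq_span_basis (monomialBasis K d), rowSpan_span]
  congr 2
  ext q s
  rw [rowMul_apply, monomialBasis_apply, polyToTensorLin_apply, map_mul, polyToTensor_X_pow]
  rfl

/-- Modulo a monic polynomial of degree `d`, right multiplication by `A` on polynomials of degree
less than `d - k` is computed without reduction; the remaining monomials contribute at most `k`
to the rank for each row of `A`. -/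
theorem abs_spanRank_sub_imageRank_le (rk : SylvesterMatrixRank R) (hf : f.Monic) {k : ℕ}
    (hk : k ≤ f.natDegree) (hA : ∀ i j, (A i j).natDegree ≤ k) :
    |rk.spanRank (polyRowSpan f A) - imageRank rk (A.map (polyToTensor K R))
      ((degreeLT K f.natDegree).map (ratIncl K))| ≤ n * k := by
  have := rk.nontrivial
  obtain ⟨e, he⟩ := Nat.exists_eq_add_of_le' hk
  obtain ⟨b, hb⟩ := exists_basis_polyQuot (R := R) hf
  have hsmall : imageRank rk (A.map (polyToTensor K R)) ((degreeLT K e).map (ratIncl K)) =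
      rk.spanRank (Submodule.span R (Set.range fun (q : Fin n × Fin e) s =>
        polyMk R f (X ^ (q.2 : ℕ) * A q.1 s))) := by
    have hx : ∀ (q : Fin n × Fin e) s, X ^ (q.2 : ℕ) * A q.1 s ∈ degreeLT R f.natDegree := by
      intro q s
      rw [mem_degreeLT, degree_lt_iff_coeff_zero]
      intro i hi
      rw [coeff_X_pow_mul']
      split_ifs
      · refine coeff_eq_zero_of_natDegree_lt ((hA q.1 s).trans_lt ?_)
        omega
      · rfl
    obtain ⟨p, hp⟩ := exists_isSplit (R := R) (monomialBasis K f.natDegree)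
    have hp' : IsSplit p fun j : Fin f.natDegree => polyToTensorLin K R (X ^ (j : ℕ)) := by
      simpa only [monomialBasis_apply, polyToTensorLin_apply, polyToTensor_X_pow] using hp
    have hb' : IsSplit (b.equivFun : PolyQuot R f →ₗ[R] Fin f.natDegree → R)
        fun j : Fin f.natDegree => polyMk R f (X ^ (j : ℕ)) := by
      simpa only [← hb] using isSplit_basis b
    rw [imageRank, rowSpan_degreeLT, spanRank_eq_rank_coeff rk _ hp' _ hx,
      spanRank_eq_rank_coeff rk _ hb' _ hx]
  have hfull : polyRowSpan f A = Submodule.span R (Set.range fun (q : Fin n × Fin f.natDegree) s =>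
      polyMk R f (X ^ (q.2 : ℕ) * A q.1 s)) := by
    rw [polyRowSpan_eq A b.span_eq]
    congr 2
    ext1 q
    rw [hb]
    rfl
  have hfg : (polyRowSpan f A).FG := by
    rw [hfull]
    exact Submodule.fg_span (Set.finite_range _)
  have h1 : rk.spanRank (Submodule.span R (Set.range fun (q : Fin n × Fin e) s =>
        polyMk R f (X ^ (q.2 : ℕ) * A q.1 s))) ≤ rk.spanRank (polyRowSpan f A) := by
    refine rk.spanRank_mono hfg (Submodule.span_le.2 ?_)
    rintro _ ⟨q, rfl⟩
    rw [hfull]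
    exact Submodule.subset_span ⟨(q.1, ⟨q.2, by omega⟩), rfl⟩
  have h2 : rk.spanRank (polyRowSpan f A) ≤
      rk.spanRank (Submodule.span R (Set.range fun (q : Fin n × Fin e) s =>
        polyMk R f (X ^ (q.2 : ℕ) * A q.1 s))) + n * k := by
    have hQ : LocallySplit R (PolyQuot R f) := fun s _ =>
      ⟨_, b, _, isSplit_basis b, by rw [b.span_eq]; exact fun _ _ => trivial⟩
    let z : Fin n × Fin k → Fin m → PolyQuot R f := fun q s =>
      polyMk R f (X ^ (e + q.2 : ℕ) * A q.1 s)
    have h3 := rk.spanRank_span_le z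
    have h4 := rk.spanRank_sup_le (hQ.pi m)
      (Submodule.fg_span (R := R) (Set.finite_range fun (q : Fin n × Fin e) s =>
        polyMk R f (X ^ (q.2 : ℕ) * A q.1 s)))
      (Submodule.fg_span (R := R) (Set.finite_range z))
    have h5 : polyRowSpan f A ≤ Submodule.span R (Set.range fun (q : Fin n × Fin e) s =>
        polyMk R f (X ^ (q.2 : ℕ) * A q.1 s)) ⊔ Submodule.span R (Set.range z) := by
      rw [hfull]
      refine Submodule.span_le.2 ?_
      rintro _ ⟨q, rfl⟩
      by_cases hq : (q.2 : ℕ) < e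
      · exact Submodule.mem_sup_left (Submodule.subset_span ⟨(q.1, ⟨q.2, hq⟩), rfl⟩)
      · refine Submodule.mem_sup_right (Submodule.subset_span ⟨(q.1, ⟨q.2 - e, by omega⟩), ?_⟩)
        have : e + (q.2 - e : ℕ) = q.2 := by omega
        simp only [z, this]
    have h6 := rk.spanRank_mono ((Submodule.fg_span (Set.finite_range _)).sup
      (Submodule.fg_span (Set.finite_range _))) h5
    simp only [Fintype.card_prod, Fintype.card_fin, Nat.cast_mul] at h3
    linarith
  have hle : (degreeLT K e).map (ratIncl K) ≤ (degreeLT K f.natDegree).map (ratIncl K) :=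
    Submodule.map_mono (degreeLT_mono (by omega))
  have h3 := imageRank_mono rk (A.map (polyToTensor K R)) hle
  have h4 := imageRank_le_add_of_le rk (A.map (polyToTensor K R)) hle
  rw [finrank_map_ratIncl, finrank_map_ratIncl, finrank_degreeLT, finrank_degreeLT, he] at h4
  push_cast at h4
  rw [← he] at h4
  rw [hsmall] at h3 h4
  rw [abs_le]
  constructor <;> linarith

/-- The normalized error in `abs_spanRank_sub_imageRank_le` is at most `n * k / deg f`. -/
theorem tendsto_rankPoly (rk : SylvesterMatrixRank R) {c : ℝ}
    (hc : Tendsto (fun N : ℕ => imageRank rk (A.map (polyToTensor K R))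
      ((degreeLT K N).map (ratIncl K)) / N) atTop (𝓝 c))
    {g : ℕ → K[X]} (hg : ∀ i, (g i).Monic) (hdeg : Tendsto (fun i => (g i).natDegree) atTop atTop) :
    Tendsto (fun i => rankPoly rk (g i) A) atTop (𝓝 c) := by
  obtain ⟨k, hk⟩ : ∃ k, ∀ i j, (A i j).natDegree ≤ k := by
    refine ⟨∑ i, ∑ j, (A i j).natDegree, fun i j => ?_⟩
    exact (Finset.single_le_sum (f := fun j => (A i j).natDegree) (fun _ _ => Nat.zero_le _)
      (Finset.mem_univ j)).trans (Finset.single_le_sum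
        (f := fun i => ∑ j, (A i j).natDegree) (fun _ _ => Nat.zero_le _) (Finset.mem_univ i))
  have h1 := hc.comp hdeg
  have h2 : Tendsto (fun i => (n * k : ℝ) / (g i).natDegree) atTop (𝓝 0) :=
    tendsto_const_nhds.div_atTop (tendsto_natCast_atTop_atTop.comp hdeg)
  refine tendsto_of_tendsto_of_dist h1 (squeeze_zero' (Eventually.of_forall fun _ => dist_nonneg)
    ?_ h2)
  filter_upwards [hdeg.eventually_ge_atTop k] with i hi
  rw [dist_comm, Real.dist_eq, rankPoly_eq A rk (hg i), Function.comp_apply, ← sub_div, abs_div,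
    abs_of_nonneg (Nat.cast_nonneg _ : (0 : ℝ) ≤ (g i).natDegree)]
  gcongr
  exact abs_spanRank_sub_imageRank_le A rk (hg i) hi hk

end PolynomialQuotient

/-! ### The limit rank function on `K(t) ⊗ R` -/

namespace FieldTensor

open SylvesterMatrixRank

section Properties

variable {K : Type u} [Field K] {E : Type w} [Field E] [Algebra K E] {R : Type v} [Ring R]
  [Algebra K R] (rk : SylvesterMatrixRank R) {n m : ℕ} (V : Submodule K E)

theorem imageRank_zero : imageRank rk (0 : Matrix (Fin n) (Fin m) (E ⊗[K] R)) V = 0 := by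
  have : rowSpan (0 : Matrix (Fin n) (Fin m) (E ⊗[K] R)) (tens R V) = ⊥ := by
    rw [eq_bot_iff]
    refine iSup_le fun i => ?_
    rintro _ ⟨x, -, rfl⟩
    simp only [Submodule.mem_bot]
    ext j
    simp [rowMul_apply]
  rw [imageRank, this, rk.spanRank_bot]

variable [FiniteDimensional K V]

theorem imageRank_one :
    imageRank rk (1 : Matrix (Fin n) (Fin n) (E ⊗[K] R)) V = n * Module.finrank K V := by
  obtain ⟨p, hp⟩ := exists_isSplit (R := R) (Module.finBasis K V)
  rw [imageRank, tens_eq_span_basis (Module.finBasis K V), rowSpan_span]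
  have h := (hp.pi n).spanRank_span_range rk
  rw [Fintype.card_prod, Fintype.card_fin, Fintype.card_fin, Nat.cast_mul] at h
  rw [← h]
  congr 3
  ext q j
  by_cases hj : j = q.1
  · subst hj
    simp [rowMul_apply]
  · simp [rowMul_apply, hj, Matrix.one_apply_ne' hj]

theorem imageRank_mul_le_left {l : ℕ} (A : Matrix (Fin n) (Fin m) (E ⊗[K] R))
    (B : Matrix (Fin m) (Fin l) (E ⊗[K] R)) : imageRank rk (A * B) V ≤ imageRank rk A V := by
  rw [imageRank, rowSpan_mul]
  exact rk.spanRank_map_le (rowSpan_tens_fg A V) _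

theorem imageRank_mul_le_of_mem {l : ℕ} {A : Matrix (Fin n) (Fin m) (E ⊗[K] R)}
    (B : Matrix (Fin m) (Fin l) (E ⊗[K] R)) {V : Submodule K E} {V' : Submodule K E}
    [FiniteDimensional K V'] (h : ∀ i j, ∀ y ∈ tens R V, y * A i j ∈ tens R V') :
    imageRank rk (A * B) V ≤ imageRank rk B V' :=
  rk.spanRank_mono (rowSpan_tens_fg B V') (rowSpan_mul_le A B h)

/-- The ranks of the blocks of an upper triangular matrix, all computed in the same bases. -/
theorem exists_imageRank_fromBlocks {k l : ℕ} (A : Matrix (Fin n) (Fin m) (E ⊗[K] R))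
    (C : Matrix (Fin n) (Fin l) (E ⊗[K] R)) (B : Matrix (Fin k) (Fin l) (E ⊗[K] R)) :
    ∃ (d : ℕ) (z : Fin (Module.finrank K V) → E ⊗[K] R) (p : E ⊗[K] R →ₗ[R] Fin d → R),
      imageRank rk A V = rk.rank (blockMatrix z p A) ∧
      imageRank rk B V = rk.rank (blockMatrix z p B) ∧
      imageRank rk (Matrix.reindex finSumFinEquiv finSumFinEquiv (Matrix.fromBlocks A C 0 B)) V =
        rk.rank (Matrix.fromBlocks (blockMatrix z p A) (blockMatrix z p C) 0
          (blockMatrix z p B)) := by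
  obtain ⟨V', hV', -, h⟩ := exists_tens_mul_mem
    (Matrix.reindex finSumFinEquiv finSumFinEquiv (Matrix.fromBlocks A C 0 B)) V
  obtain ⟨p, hp⟩ := exists_isSplit (R := R) (Module.finBasis K V')
  rw [tens_eq_span_basis (Module.finBasis K V')] at h
  have hz (a) : (Module.finBasis K V a : E) ⊗ₜ[K] (1 : R) ∈ tens R V :=
    tmul_mem_tens (Subtype.coe_prop _) 1
  refine ⟨_, fun a => (Module.finBasis K V a : E) ⊗ₜ[K] (1 : R), p, ?_, ?_, ?_⟩
  · rw [imageRank, tens_eq_span_basis (Module.finBasis K V)]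
    refine spanRank_rowSpan_eq_rank rk A _ hp fun a i j => ?_
    simpa using h (finSumFinEquiv (Sum.inl i)) (finSumFinEquiv (Sum.inl j)) _ (hz a)
  · rw [imageRank, tens_eq_span_basis (Module.finBasis K V)]
    refine spanRank_rowSpan_eq_rank rk B _ hp fun a i j => ?_
    simpa using h (finSumFinEquiv (Sum.inr i)) (finSumFinEquiv (Sum.inr j)) _ (hz a)
  · rw [imageRank, tens_eq_span_basis (Module.finBasis K V),
      spanRank_rowSpan_eq_rank rk _ _ hp fun a i j => h i j _ (hz a),
      rank_blockMatrix_fromBlocks, blockMatrix_zero]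

theorem imageRank_fromBlocks_diag {k l : ℕ} (A : Matrix (Fin n) (Fin m) (E ⊗[K] R))
    (B : Matrix (Fin k) (Fin l) (E ⊗[K] R)) :
    imageRank rk (Matrix.reindex finSumFinEquiv finSumFinEquiv (Matrix.fromBlocks A 0 0 B)) V =
      imageRank rk A V + imageRank rk B V := by
  obtain ⟨d, z, p, h1, h2, h3⟩ := exists_imageRank_fromBlocks rk V A 0 B
  rw [h1, h2, h3, blockMatrix_zero, rk.rank_fromBlocks_diag]

theorem le_imageRank_fromBlocks {k l : ℕ} (A : Matrix (Fin n) (Fin m) (E ⊗[K] R))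
    (C : Matrix (Fin n) (Fin l) (E ⊗[K] R)) (B : Matrix (Fin k) (Fin l) (E ⊗[K] R)) :
    imageRank rk A V + imageRank rk B V ≤
      imageRank rk (Matrix.reindex finSumFinEquiv finSumFinEquiv (Matrix.fromBlocks A C 0 B)) V := by
  obtain ⟨d, z, p, h1, h2, h3⟩ := exists_imageRank_fromBlocks rk V A C B
  rw [h1, h2, h3]
  exact rk.le_rank_fromBlocks _ _ _

end Properties

section Limit

variable {K : Type u} [Field K] {E : Type w} [Field E] [Algebra K E] {R : Type v} [Ring R]
  [Algebra K R] (rk : SylvesterMatrixRank R) {n m : ℕ}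

theorem exists_eq_tens (rk : SylvesterMatrixRank R) (W : NonzeroMem (fieldSystem K E R)) :
    ∃ V : Submodule K E, FiniteDimensional K V ∧ W.1 = tens R V ∧
      0 < (Module.finrank K V : ℝ) := by
  have := rk.nontrivial
  obtain ⟨W, ⟨V, hV, rfl⟩, h0⟩ := W
  refine ⟨V, hV, rfl, ?_⟩
  have h : V ≠ ⊥ := tens_ne_bot.1 h0
  rw [Nat.cast_pos, Module.finrank_pos_iff]
  exact Submodule.nontrivial_iff_ne_bot.2 h

theorem normalizedRankAt_eq (A : Matrix (Fin n) (Fin m) (E ⊗[K] R))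
    {W : NonzeroMem (fieldSystem K E R)} {V : Submodule K E} [FiniteDimensional K V]
    (hW : W.1 = tens R V) :
    normalizedRankAt rk (fieldSystem K E R) A W = imageRank rk A V / Module.finrank K V := by
  rw [normalizedRankAt, hW, rankAt_tens, freeDim_tens rk]
  rfl

theorem exists_of_isEpsInvariant (rk : SylvesterMatrixRank R) {s : Finset (E ⊗[K] R)} {ε : ℝ}
    {V : Submodule K E} [FiniteDimensional K V]
    (h : IsEpsInvariant (fieldSystem K E R) s ε (tens R V)) :
    ∃ V' : Submodule K E, FiniteDimensional K V' ∧ V ≤ V' ∧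
      (∀ x ∈ tens R V, ∀ y ∈ s, x * y ∈ tens R V') ∧
      (Module.finrank K V' : ℝ) ≤ (1 + ε) * Module.finrank K V := by
  have := rk.nontrivial
  obtain ⟨_, ⟨V', hV', rfl⟩, hle, hs, hd⟩ := h
  change (freeDim R (tens R V') : ℝ) ≤ (1 + ε) * (freeDim R (tens R V) : ℝ) at hd
  rw [freeDim_tens rk, freeDim_tens rk] at hd
  exact ⟨V', hV', tens_le_tens_iff.1 hle, hs, hd⟩

/-- Bounded real functions converge along ultrafilters. -/
theorem tendsto_rankF (ω : Ultrafilter (NonzeroMem (fieldSystem K E R)))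
    (A : Matrix (Fin n) (Fin m) (E ⊗[K] R)) :
    Tendsto (normalizedRankAt rk (fieldSystem K E R) A) ω
      (𝓝 (rankF rk (fieldSystem K E R) ω A)) := by
  have hmem : ∀ W, normalizedRankAt rk (fieldSystem K E R) A W ∈ Set.Icc (0 : ℝ) n := by
    intro W
    obtain ⟨V, hV, hW, hpos⟩ := exists_eq_tens rk W
    rw [normalizedRankAt_eq rk A hW]
    exact ⟨div_nonneg (imageRank_nonneg rk A V) hpos.le,
      (div_le_iff₀ hpos).2 (imageRank_le rk A V)⟩
  obtain ⟨a, -, ha⟩ := (isCompact_Icc (a := (0 : ℝ)) (b := n)).ultrafilter_le_nhds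
    (ω.map (normalizedRankAt rk (fieldSystem K E R) A))
    (le_principal_iff.2 (Filter.mem_map.2 (Filter.univ_mem' hmem)))
  exact tendsto_nhds_limUnder ⟨a, ha⟩

/-- The matrix rank function given by `rankF` for a non-principal ultrafilter. Only the inequality
`rk (A B) ≤ rk B` uses almost invariance: it compares `W ^ n A B` with `W' ^ m B` for some `W'` that
contains `W` and the `W A i j` and is not much larger than `W`. -/
def sylvesterRankF (ω : Ultrafilter (NonzeroMem (fieldSystem K E R))) (hω : IsNonPrincipal _ ω) :
    SylvesterMatrixRank (E ⊗[K] R) where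
  rk A := rankF rk (fieldSystem K E R) ω A
  nonneg A := by
    refine ge_of_tendsto' (tendsto_rankF rk ω A) fun W => ?_
    obtain ⟨V, hV, hW, hpos⟩ := exists_eq_tens rk W
    rw [normalizedRankAt_eq rk A hW]
    exact div_nonneg (imageRank_nonneg rk A V) hpos.le
  zero n m := by
    refine tendsto_nhds_unique (tendsto_rankF rk ω _) (tendsto_const_nhds.congr fun W => ?_)
    obtain ⟨V, hV, hW, hpos⟩ := exists_eq_tens rk W
    rw [normalizedRankAt_eq rk _ hW, imageRank_zero, zero_div]
  one := by
    refine tendsto_nhds_unique (tendsto_rankF rk ω _) (tendsto_const_nhds.congr fun W => ?_)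
    obtain ⟨V, hV, hW, hpos⟩ := exists_eq_tens rk W
    rw [normalizedRankAt_eq rk _ hW, imageRank_one, Nat.cast_one, one_mul, div_self hpos.ne']
  mul_le_left A B := by
    refine le_of_tendsto_of_tendsto' (tendsto_rankF rk ω _) (tendsto_rankF rk ω _) fun W => ?_
    obtain ⟨V, hV, hW, hpos⟩ := exists_eq_tens rk W
    rw [normalizedRankAt_eq rk _ hW, normalizedRankAt_eq rk _ hW]
    gcongr
    exact imageRank_mul_le_left rk V A B
  mul_le_right {n m l} A B := by
    classical
    refine le_of_forall_pos_le_add fun δ hδ => ?_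
    have hε : 0 < δ / (m + 1 : ℝ) := by positivity
    refine le_of_tendsto_of_tendsto (tendsto_rankF rk ω _)
      ((tendsto_rankF rk ω B).add tendsto_const_nhds) ?_
    have := hω (Finset.univ.image fun q : Fin n × Fin m => A q.1 q.2) _ hε
    filter_upwards [this] with W hinv
    obtain ⟨V, hV, hW, hpos⟩ := exists_eq_tens rk W
    rw [hW] at hinv
    obtain ⟨V', hV', hle, hs, hd⟩ := exists_of_isEpsInvariant rk hinv
    rw [normalizedRankAt_eq rk _ hW, normalizedRankAt_eq rk _ hW, div_add' _ _ _ hpos.ne']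
    gcongr
    have h1 := imageRank_mul_le_of_mem rk (V := V) (A := A) B fun i j y hy =>
      hs y hy (A i j) (Finset.mem_image_of_mem _ (Finset.mem_univ (i, j)))
    have h2 := imageRank_le_add_of_le rk B hle
    have h3 : (m : ℝ) * ((Module.finrank K V' : ℝ) - Module.finrank K V) ≤
        m * (δ / (m + 1) * Module.finrank K V) := by
      gcongr
      linarith
    have h4 : (m : ℝ) * (δ / (m + 1) * Module.finrank K V) ≤ δ * Module.finrank K V := by
      calc (m : ℝ) * (δ / (m + 1) * Module.finrank K V) =
          (m / (m + 1)) * (δ * Module.finrank K V) := by ring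
        _ ≤ 1 * (δ * Module.finrank K V) := by
          gcongr
          rw [div_le_one (by positivity)]
          linarith
        _ = _ := one_mul _
    linarith
  diag A B := by
    refine tendsto_nhds_unique (tendsto_rankF rk ω _)
      (((tendsto_rankF rk ω A).add (tendsto_rankF rk ω B)).congr fun W => ?_)
    obtain ⟨V, hV, hW, hpos⟩ := exists_eq_tens rk W
    rw [normalizedRankAt_eq rk _ hW, normalizedRankAt_eq rk _ hW, normalizedRankAt_eq rk _ hW,
      imageRank_fromBlocks_diag, add_div]
  triangular A C B := by
    refine le_of_tendsto_of_tendsto' ((tendsto_rankF rk ω A).add (tendsto_rankF rk ω B))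
      (tendsto_rankF rk ω _) fun W => ?_
    obtain ⟨V, hV, hW, hpos⟩ := exists_eq_tens rk W
    rw [normalizedRankAt_eq rk _ hW, normalizedRankAt_eq rk _ hW, normalizedRankAt_eq rk _ hW,
      ← add_div]
    gcongr
    exact le_imageRank_fromBlocks rk V A C B

end Limit

section RationalFunctions

open Polynomial

variable {K : Type u} [Field K] {R : Type v} [Ring R] [Algebra K R] {n m : ℕ}

/-- The ultralimit agrees with the limit along the subspaces `K[t]_{< N}`. The lower bound for the
normalized rank holds at every `W`; the upper bound needs invariance under powers of `t`. -/
theorem tendsto_imageRank_degreeLT (rk : SylvesterMatrixRank R)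
    {ω : Ultrafilter (NonzeroMem (fieldSystem K (RatFunc K) R))} (hω : IsNonPrincipal _ ω)
    (A : Matrix (Fin n) (Fin m) (RatFunc K ⊗[K] R)) :
    Tendsto (fun N : ℕ => imageRank rk A ((degreeLT K N).map (ratIncl K)) / N) atTop
      (𝓝 (rankF rk (fieldSystem K (RatFunc K) R) ω A)) := by
  classical
  have := rk.nontrivial
  obtain ⟨c, hc, hlow, hup⟩ := exists_asymptotic_rank rk A
  suffices h : rankF rk (fieldSystem K (RatFunc K) R) ω A = c by rwa [h]
  apply le_antisymm
  · refine le_of_forall_pos_le_add fun δ hδ => ?_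
    obtain ⟨k, ε, hε, hk⟩ := hup δ hδ
    refine le_of_tendsto (tendsto_rankF rk ω A) ?_
    filter_upwards [hω ((Finset.range (k + 1)).image fun i =>
      (RatFunc.X ^ i : RatFunc K) ⊗ₜ[K] (1 : R)) ε hε] with W hinv
    obtain ⟨V, hV, hW, hpos⟩ := exists_eq_tens rk W
    rw [hW] at hinv
    obtain ⟨V', hV', hle, hs, hd⟩ := exists_of_isEpsInvariant rk hinv
    rw [normalizedRankAt_eq rk _ hW, div_le_iff₀ hpos]
    refine hk V V' hle (fun i hi v hv => ?_) hd
    have h1 := hs _ (tmul_mem_tens hv 1) _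
      (Finset.mem_image_of_mem _ (Finset.mem_range.2 (Nat.lt_succ_of_le hi)))
    rw [Algebra.TensorProduct.tmul_mul_tmul, one_mul] at h1
    exact tmul_one_mem_tens_iff.1 h1
  · refine ge_of_tendsto' (tendsto_rankF rk ω A) fun W => ?_
    obtain ⟨V, hV, hW, hpos⟩ := exists_eq_tens rk W
    rw [normalizedRankAt_eq rk _ hW, le_div_iff₀ hpos]
    exact hlow V

/-- For `W` take `K[t]_{< M}` with `M` large; a common denominator `q` of the given elements and the
degrees of the numerators are independent of `M`. -/
theorem exists_isEpsInvariant (rk : SylvesterMatrixRank R) (s : Finset (RatFunc K ⊗[K] R)) {ε : ℝ}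
    (hε : 0 < ε) : ∃ W : NonzeroMem (fieldSystem K (RatFunc K) R),
      IsEpsInvariant (fieldSystem K (RatFunc K) R) s ε W.1 := by
  have := rk.nontrivial
  obtain ⟨L, hL, hs⟩ := exists_subset_tens (s : Set (RatFunc K ⊗[K] R)) s.finite_toSet
  obtain ⟨q, hq, V₁, hV₁, hqV⟩ := exists_map_mul_eq_map_ratIncl (L ⊔ K ∙ (1 : RatFunc K))
  obtain ⟨N, hN⟩ := exists_le_degreeLT V₁
  obtain ⟨M, hM⟩ := exists_nat_ge (N / ε)
  have hM' : (N : ℝ) ≤ ε * (M + 1 : ℕ) := by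
    rw [div_le_iff₀ hε] at hM
    push_cast
    linarith
  set q' := ratIncl K q with hq'
  have hq0 : q' ≠ 0 := ratIncl_ne_zero hq
  set U := (degreeLT K (M + 1)).map (ratIncl K)
  set U' := ((degreeLT K (M + 1 + N)).map (ratIncl K)).map (LinearMap.mulLeft K q'⁻¹)
  have hU : Module.finrank K U = M + 1 := by rw [finrank_map_ratIncl, finrank_degreeLT]
  have hU' : Module.finrank K U' = M + 1 + N := by
    rw [← (Submodule.equivMapOfInjective (LinearMap.mulLeft K q'⁻¹)
      (mul_right_injective₀ (inv_ne_zero hq0)) _).finrank_eq, finrank_map_ratIncl, finrank_degreeLT]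
  have hmul : ∀ u ∈ U, ∀ l ∈ L ⊔ K ∙ (1 : RatFunc K), u * l ∈ U' := by
    rintro _ ⟨p, hp, rfl⟩ l hl
    have h1 : q' * l ∈ V₁.map (ratIncl K) := by
      rw [← hqV]
      exact ⟨l, hl, rfl⟩
    obtain ⟨r, hr, hrl⟩ := h1
    refine ⟨ratIncl K (p * r), ⟨p * r, ?_, rfl⟩, ?_⟩
    · have hp' := mem_degreeLT.1 hp
      have hr' := mem_degreeLT.1 (hN hr)
      rw [SetLike.mem_coe, mem_degreeLT, degree_mul]
      rcases eq_or_ne p 0 with rfl | hp0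
      · simp
      rcases eq_or_ne r 0 with rfl | hr0
      · simp
      rw [degree_eq_natDegree hp0] at hp' ⊢
      rw [degree_eq_natDegree hr0] at hr' ⊢
      norm_cast at hp' hr' ⊢
      omega
    · have h2 : ratIncl K (p * r) = ratIncl K p * (q' * l) := by
        rw [← hrl]
        exact map_mul (algebraMap K[X] (RatFunc K)) p r
      rw [LinearMap.mulLeft_apply, h2]
      field_simp
  have hle : U ≤ U' := fun u hu => by
    simpa using hmul u hu 1 (Submodule.mem_sup_right (Submodule.mem_span_singleton_self 1))
  have hU0 : U ≠ ⊥ := by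
    intro h
    rw [h, finrank_bot] at hU
    omega
  refine ⟨⟨tens R U, ⟨U, inferInstance, rfl⟩, tens_ne_bot.2 hU0⟩, tens R U',
    ⟨U', inferInstance, rfl⟩, tens_mono hle, fun x hx y hy => ?_, ?_⟩
  · refine mul_mem_tens (L := L) (Submodule.mul_le.2 fun u hu l hl => ?_) hx (hs hy)
    exact hmul u hu l (Submodule.mem_sup_left hl)
  · rw [freeDim_tens rk, freeDim_tens rk, hU, hU']
    push_cast at hM' ⊢
    linarith

theorem exists_isNonPrincipal (rk : SylvesterMatrixRank R) :
    ∃ ω : Ultrafilter (NonzeroMem (fieldSystem K (RatFunc K) R)), IsNonPrincipal _ ω := by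
  classical
  let T : Finset (RatFunc K ⊗[K] R) × ℝ → Set (NonzeroMem (fieldSystem K (RatFunc K) R)) :=
    fun x => {W | IsEpsInvariant (fieldSystem K (RatFunc K) R) x.1 x.2 W.1}
  obtain ⟨ω, hω⟩ := Ultrafilter.exists_ultrafilter_of_finite_inter_nonempty
    (T '' {x | 0 < x.2}) (by
      intro t ht
      have key : ∃ x : Finset (RatFunc K ⊗[K] R) × ℝ, 0 < x.2 ∧ ∀ A ∈ t, T x ⊆ A := by
        induction t using Finset.induction_on with
        | empty => exact ⟨(∅, 1), one_pos, by simp⟩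
        | insert A t _ ih =>
          rw [Finset.coe_insert, Set.insert_subset_iff] at ht
          obtain ⟨x, hx, hxt⟩ := ih ht.2
          obtain ⟨y, hy, rfl⟩ := ht.1
          have hanti : ∀ z : Finset (RatFunc K ⊗[K] R) × ℝ, z.1 ⊆ x.1 ∪ y.1 → min x.2 y.2 ≤ z.2 →
              T (x.1 ∪ y.1, min x.2 y.2) ⊆ T z := by
            rintro z h1 h2 W ⟨W', hW', hle, hs, hd⟩
            exact ⟨W', hW', hle, fun a ha b hb => hs a ha b (h1 hb), hd.trans (by gcongr)⟩
          refine ⟨(x.1 ∪ y.1, min x.2 y.2), lt_min hx hy, fun B hB => ?_⟩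
          rcases Finset.mem_insert.1 hB with rfl | hB
          · exact hanti y Finset.subset_union_right (min_le_right _ _)
          · exact (hanti x Finset.subset_union_left (min_le_left _ _)).trans (hxt B hB)
      obtain ⟨x, hx, hxt⟩ := key
      obtain ⟨W, hW⟩ := exists_isEpsInvariant rk x.1 hx
      exact ⟨W, fun A hA => hxt A hA hW⟩)
  exact ⟨ω, fun s ε hε => hω ⟨(s, ε), hε, rfl⟩⟩

theorem rk_smul_tmul_one (ρ : SylvesterMatrixRank (RatFunc K ⊗[K] R)) {q : RatFunc K} (hq : q ≠ 0)
    (B : Matrix (Fin n) (Fin m) (RatFunc K ⊗[K] R)) :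
    ρ.rk ((q ⊗ₜ[K] (1 : R)) • B) = ρ.rk B := by
  have hle (q : RatFunc K) (B : Matrix (Fin n) (Fin m) (RatFunc K ⊗[K] R)) :
      ρ.rk ((q ⊗ₜ[K] (1 : R)) • B) ≤ ρ.rk B := by
    have h := ρ.mul_le_right
      ((q ⊗ₜ[K] (1 : R)) • (1 : Matrix (Fin n) (Fin n) (RatFunc K ⊗[K] R))) B
    rwa [Matrix.smul_mul, Matrix.one_mul] at h
  refine le_antisymm (hle q B) ?_
  have h := hle q⁻¹ ((q ⊗ₜ[K] (1 : R)) • B)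
  rwa [smul_smul, Algebra.TensorProduct.tmul_mul_tmul, inv_mul_cancel₀ hq, one_mul,
    ← Algebra.TensorProduct.one_def, one_smul] at h

/-- Clearing denominators: every matrix over `K(t) ⊗ R` is a unit multiple of a matrix over
`R[t]`. -/
theorem exists_smul_eq_map (B : Matrix (Fin n) (Fin m) (RatFunc K ⊗[K] R)) :
    ∃ q : RatFunc K, q ≠ 0 ∧ ∃ A : Matrix (Fin n) (Fin m) R[X],
      (q ⊗ₜ[K] (1 : R)) • B = A.map (polyToTensor K R) := by
  obtain ⟨L, hL, hs⟩ := exists_subset_tens (Set.range fun x : Fin n × Fin m => B x.1 x.2)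
    (Set.finite_range _)
  obtain ⟨q, hq, V, hV, hqV⟩ := exists_map_mul_eq_map_ratIncl L
  obtain ⟨N, hN⟩ := exists_le_degreeLT V
  refine ⟨ratIncl K q, ratIncl_ne_zero hq, ?_⟩
  have hmem (i j) : ∃ p : R[X], polyToTensor K R p = (ratIncl K q ⊗ₜ[K] (1 : R)) * B i j := by
    have h1 : mulLeftTensor (ratIncl K q) (B i j) ∈
        tens R ((degreeLT K N).map (ratIncl K)) := by
      refine tens_mono (hqV.trans_le (Submodule.map_mono hN)) ?_
      rw [← map_mulLeftTensor]
      exact ⟨_, hs ⟨(i, j), rfl⟩, rfl⟩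
    have h2 : tens R ((degreeLT K N).map (ratIncl K)) ≤
        LinearMap.range (polyToTensorLin K R) := by
      rw [tens_eq_span_basis (monomialBasis K N), Submodule.span_le]
      rintro _ ⟨k, rfl⟩
      refine ⟨X ^ (k : ℕ), ?_⟩
      simp only [polyToTensorLin_apply, polyToTensor_X_pow, monomialBasis_apply]
    exact h2 h1
  choose A hA using hmem
  refine ⟨Matrix.of A, ?_⟩
  ext i j
  exact (hA i j).symm

theorem rk_eq_of_isJZExtension {rk : SylvesterMatrixRank R}
    {ρ ρ' : SylvesterMatrixRank (RatFunc K ⊗[K] R)} (h : IsJZExtension rk ρ)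
    (h' : IsJZExtension rk ρ') (B : Matrix (Fin n) (Fin m) (RatFunc K ⊗[K] R)) :
    ρ.rk B = ρ'.rk B := by
  obtain ⟨q, hq, A, hA⟩ := exists_smul_eq_map B
  rw [← rk_smul_tmul_one ρ hq, ← rk_smul_tmul_one ρ' hq, hA]
  exact tendsto_nhds_unique (h n m A) (h' n m A)

theorem isJZExtension_sylvesterRankF (rk : SylvesterMatrixRank R)
    {ω : Ultrafilter (NonzeroMem (fieldSystem K (RatFunc K) R))} (hω : IsNonPrincipal _ ω) :
    IsJZExtension rk (sylvesterRankF rk ω hω) := fun _ _ A =>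
  tendsto_rankPoly A rk (tendsto_imageRank_degreeLT rk hω _) (fun i => monic_X_pow i)
    (tendsto_id.congr fun i => (natDegree_X_pow i).symm)

end RationalFunctions

end FieldTensor

theorem SylvesterMatrixRank.ext_of_rk {R : Type v} [Ring R] {ρ ρ' : SylvesterMatrixRank R}
    (h : ∀ (n m : ℕ) (A : Matrix (Fin n) (Fin m) R), ρ.rk A = ρ'.rk A) : ρ = ρ' := by
  obtain ⟨f, _, _, _, _, _, _, _⟩ := ρ
  obtain ⟨f', _, _, _, _, _, _, _⟩ := ρ'
  have : @f = @f' := by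
    funext n m A
    exact h n m A
  subst this
  rfl

end

theorem proposition9p4 {K : Type u} [Field K] {R : Type v} [Ring R] [Algebra K R]
    (rk : SylvesterMatrixRank R) :
    -- non-principal ultrafilters on the nonzero members of the approximation system exist
    (∃ ω : Ultrafilter (NonzeroMem (fieldSystem K (RatFunc K) R)), IsNonPrincipal _ ω) ∧
    -- for every choice of one, the ultralimit defining `rk_F` exists and is the limit of `rk_{f_i}`
    (∀ ω : Ultrafilter (NonzeroMem (fieldSystem K (RatFunc K) R)), IsNonPrincipal _ ω →
      (∀ (n m : ℕ) (B : Matrix (Fin n) (Fin m) (RatFunc K ⊗[K] R)),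
        Tendsto (normalizedRankAt rk (fieldSystem K (RatFunc K) R) B) ω
          (𝓝 (rankF rk (fieldSystem K (RatFunc K) R) ω B))) ∧
      (∀ f : ℕ → K[X], (∀ i, (f i).Monic) → Tendsto (fun i => (f i).natDegree) atTop atTop →
        ∀ (n m : ℕ) (A : Matrix (Fin n) (Fin m) R[X]),
          Tendsto (fun i => rankPoly rk (f i) A) atTop
            (𝓝 (rankF rk (fieldSystem K (RatFunc K) R) ω (A.map (polyToTensor K R)))))) ∧
    -- if `rk` is regular, Jaikin-Zapirain's extension exists, is unique, and equals `rk_F`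
    (SylvesterMatrixRank.IsRegular.{v, w} rk →
      (∃! ρ : SylvesterMatrixRank (RatFunc K ⊗[K] R), IsJZExtension rk ρ) ∧
      ∀ ρ : SylvesterMatrixRank (RatFunc K ⊗[K] R), IsJZExtension rk ρ →
        ∀ ω : Ultrafilter (NonzeroMem (fieldSystem K (RatFunc K) R)), IsNonPrincipal _ ω →
          ∀ (n m : ℕ) (B : Matrix (Fin n) (Fin m) (RatFunc K ⊗[K] R)),
            rankF rk (fieldSystem K (RatFunc K) R) ω B = ρ.rk B) := by
  refine ⟨FieldTensor.exists_isNonPrincipal rk, fun ω hω =>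
    ⟨fun n m B => FieldTensor.tendsto_rankF rk ω B, fun f hf hdeg n m A =>
      tendsto_rankPoly A rk (FieldTensor.tendsto_imageRank_degreeLT rk hω _) hf hdeg⟩, fun _ => ?_⟩
  obtain ⟨ω, hω⟩ := FieldTensor.exists_isNonPrincipal (K := K) rk
  refine ⟨⟨_, FieldTensor.isJZExtension_sylvesterRankF rk hω, fun ρ hρ => ?_⟩,
    fun ρ hρ ω' hω' n m B => ?_⟩
  · exact SylvesterMatrixRank.ext_of_rk fun _ _ A => FieldTensor.rk_eq_of_isJZExtension hρ
      (FieldTensor.isJZExtension_sylvesterRankF rk hω) A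
  · exact FieldTensor.rk_eq_of_isJZExtension (FieldTensor.isJZExtension_sylvesterRankF rk hω') hρ B
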